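/- Let $\rho\in\mathbb R$, $N\ge 1$, let $\lambda_1,\dots,\lambda_{2N}$ be nonzero complex numbers, and let $\Omega\subseteq\mathbb R^2$ be open (for instance $\Omega=\mathbb R^2$). All functions of $(x,t)$ are complex valued and $C^\infty$ on the sets where they are considered. Consider the coupled system $$\begin{aligned} &\mathrm i q_t+\mathrm i q_{xxx}+(3qr+2\rho)q_{xx}+3rq_x^2+\tfrac12\left(-9\mathrm i q^2r^2-20\mathrm i\rho qr+8\mathrm i\rho^2+6qr_x\right)q_x\\ &\qquad+\mathrm i(-3q^3r-2\rho q^2)r_x-3\rho r^2q^3-4\rho^2rq^2+8(\rho^3-\rho^2)q=0,\\ &\mathrm i r_t+\mathrm i r_{xxx}-(3qr+2\rho)r_{xx}-3qr_x^2+\tfrac12\left(-9\mathrm i q^2r^2-20\mathrm i\rho qr+8\mathrm i\rho^2-6rq_x\right)r_x\\ &\qquad+\mathrm i(-3r^3q-2\rho r^2)q_x+3\rho r^3q^2+4\rho^2r^2q+8(-\rho^3+\rho^2)r=0, \end{aligned}\tag{1}$$ and its Lax pair $\Psi_x=P\Psi$, $\Psi_t=Q\Psi$, where $P=P(q,r;\lambda)$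 and $Q=Q(q,r;\lambda)$ are, for $\lambda\neq0$, $$P=\begin{pmatrix}-\frac{\mathrm i}{\lambda^2}+\mathrm i\rho&\frac q\lambda\\ \frac r\lambda&\frac{\mathrm i}{\lambda^2}-\mathrm i\rho\end{pmatrix},\qquad Q=\begin{pmatrix}Q_1&Q_2\\Q_3&-Q_1\end{pmatrix},$$ $$\begin{aligned} Q_1&=\left(-\tfrac32\mathrm i q^2r^2-r_xq+q_xr\right)\lambda^{-2}-4\mathrm i\rho^2+(-2\mathrm i qr+8\mathrm i\rho)\lambda^{-4}-4\mathrm i\lambda^{-6},\\ Q_2&=\left(-q_{xx}+3\mathrm i q_xqr+\tfrac32q^3r^2+2\rho q^2r-4\rho^2q\right)\lambda^{-1}+\left(2\mathrm i q_x+2q^2r-4\rho q\right)\lambda^{-3}+4q\lambda^{-5},\\ Q_3&=\left(-r_{xx}-3\mathrm i r_xqr+\tfrac32q^2r^3+2\rho qr^2-4\rho^2r\right)\lambda^{-1}+\left(-2\mathrm i r_x+2qr^2-4\rho r\right)\lambda^{-3}+4r\lambda^{-5}. \end{aligned}$$ Given functions $\Phi_k=(\phi_{1,k},\phi_{2,k})^T$,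 $k=1,\dots,2N$, let $B_{12}$ and $B_{22}$ be the $2N\times2N$ matrices whose $k$-th rows are, respectively, $$(\lambda_k^{2N-2}\phi_{1,k},\ \lambda_k^{2N-1}\phi_{2,k},\ \lambda_k^{2N-4}\phi_{1,k},\ \lambda_k^{2N-3}\phi_{2,k},\ \dots,\ \phi_{1,k},\ \lambda_k\phi_{2,k}),$$ $$(\lambda_k^{2N-1}\phi_{1,k},\ \lambda_k^{2N-2}\phi_{2,k},\ \lambda_k^{2N-3}\phi_{1,k},\ \lambda_k^{2N-4}\phi_{2,k},\ \dots,\ \lambda_k\phi_{1,k},\ \phi_{2,k}).$$ Let $B_{11}$ be $B_{12}$ with its second column replaced by $(-\lambda_k^{2N}\phi_{1,k})_{k}$, and let $B_{21}$ be $B_{22}$ with its first column replaced by $(-\lambda_k^{2N}\phi_{2,k})_{k}$. Let $\Omega'$ be the set of points of $\Omega$ at which $|B_{12}|\ne0$ and $|B_{22}|\neq0$. On $\Omega'$ put $$A_{2,N-1}=\frac{|B_{11}|}{|B_{12}|},\qquad A_{3,N-1}=\frac{|B_{21}|}{|B_{22}|},$$ $$q[N]=q-2\mathrm i\rho A_{2,N-1}+\partial_xA_{2,N-1},\qquad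 r[N]=r+2\mathrm i\rho A_{3,N-1}+\partial_xA_{3,N-1}.$$ **(a)** Let $(q,r)$ be a solution of (1) on $\Omega$ and, for each $k$, let $\Phi_k$ be an eigenfunction (a solution on $\Omega$) of the Lax pair of $(q,r)$ at $\lambda=\lambda_k$. Then $(q[N],r[N])$ is a solution of (1) on $\Omega'$. It is given by an $N$-fold Darboux transformation: there are smooth functions $A_{i,j}$ on $\Omega'$ ($1\le i\le4$, $0\le j\le N-1$), with $A_{2,N-1}$ and $A_{3,N-1}$ as above, such that the matrix $$T(\lambda)=\begin{pmatrix}\lambda^{2N}+\sum_{j=0}^{N-1}A_{1,j}\lambda^{2j}&\sum_{j=0}^{N-1}A_{2,j}\lambda^{2j+1}\\ \sum_{j=0}^{N-1}A_{3,j}\lambda^{2j+1}&\lambda^{2N}+\sum_{j=0}^{N-1}A_{4,j}\lambda^{2j}\end{pmatrix}$$ satisfies on $\Omega'$ that $T(\lambda_k)\Phi_k=0$ for all $k$ and, for every $\lambda\ne0$, $$T_x+T\,P(q,r;\lambda)=P(q[N],r[N];\lambda)\,T,\qquad T_t+T\,Q(q,r;\lambda)=Q(q[N],r[N];\lambda)\,T.$$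 **(b)** Suppose that $\Omega$ is invariant under $(x,t)\mapsto(-x,-t)$, that $q$ solves on $\Omega$ the reverse space-time nonlocal equation $$\begin{aligned} &\mathrm i q_t+\mathrm i q_{xxx}-3\left[qq(-x,-t)q_x+\tfrac12\mathrm i q^3q^2(-x,-t)\right]_x+\left[2q_{xx}-3q^3q^2(-x,-t)\right]\rho\\ &\quad+\left[-2\mathrm i q^2q_x(-x,-t)+10\mathrm i qq(-x,-t)q_x\right]\rho+\left[4q^2q(-x,-t)+4\mathrm i q_x-8q\right]\rho^2+8q\rho^3=0, \end{aligned}\tag{2}$$ where $q_x(-x,-t)$ is the value of $q_x$ at $(-x,-t)$. Put $r(x,t)=-q(-x,-t)$, and for each $k$ let $\Phi_k$ be an eigenfunction on $\Omega$ of the Lax pair of $(q,r)$ at $\lambda=\lambda_k$ with $\phi_{1,k}(x,t)=\phi_{2,k}(-x,-t)$ on $\Omega$. Then $\Omega'$ is invariant under $(x,t)\mapsto(-x,-t)$, $q[N]$ solves (2) on $\Omega'$, $r[N](x,t)=-q[N](-x,-t)$ on $\Omega'$, and there is a matrix $T(\lambda)$ with all the properties in (a), now with $r(x,t)=-q(-x,-t)$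 and $r[N](x,t)=-q[N](-x,-t)$. -/

import Mathlib

open scoped ContDiff

noncomputable section

namespace SelfSteepening

/-- Complex-valued functions of the two real variables `x` (first) and `t` (second). -/
abbrev Field := ℝ → ℝ → ℂ

/-- Partial derivative in `x`. -/
def dx (f : Field) : Field := fun x t => deriv (fun s => f s t) x

/-- Partial derivative in `t`. -/
def dt (f : Field) : Field := fun x t => deriv (fun s => f x s) t

/-- Joint `C^∞` smoothness on a set of points `(x, t)`. -/
def Smooth (Ω : Set (ℝ × ℝ)) (f : Field) : Prop :=
  ContDiffOn ℝ ∞ (fun p : ℝ × ℝ => f p.1 p.2) Ω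

/-- `(q, r)` is a smooth solution on `Ω` of the coupled `q`-`r` system with parameter `ρ`. -/
structure IsCoupledSolution (ρ : ℝ) (Ω : Set (ℝ × ℝ)) (q r : Field) : Prop where
  smooth_q : Smooth Ω q
  smooth_r : Smooth Ω r
  eq_q : ∀ x t, (x, t) ∈ Ω →
    Complex.I * dt q x t + Complex.I * dx (dx (dx q)) x t
      + (3 * q x t * r x t + 2 * ρ) * dx (dx q) x t
      + 3 * r x t * (dx q x t) ^ 2
      + 1 / 2 * (-9 * Complex.I * (q x t) ^ 2 * (r x t) ^ 2
          - 20 * Complex.I * ρ * q x t * r x t + 8 * Complex.I * ρ ^ 2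
          + 6 * q x t * dx r x t) * dx q x t
      + Complex.I * (-3 * (q x t) ^ 3 * r x t - 2 * ρ * (q x t) ^ 2) * dx r x t
      - 3 * ρ * (r x t) ^ 2 * (q x t) ^ 3
      - 4 * ρ ^ 2 * r x t * (q x t) ^ 2
      + 8 * (ρ ^ 3 - ρ ^ 2) * q x t = 0
  eq_r : ∀ x t, (x, t) ∈ Ω →
    Complex.I * dt r x t + Complex.I * dx (dx (dx r)) x t
      - (3 * q x t * r x t + 2 * ρ) * dx (dx r) x t
      - 3 * q x t * (dx r x t) ^ 2
      + 1 / 2 * (-9 * Complex.I * (q x t) ^ 2 * (r x t) ^ 2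
          - 20 * Complex.I * ρ * q x t * r x t + 8 * Complex.I * ρ ^ 2
          - 6 * r x t * dx q x t) * dx r x t
      + Complex.I * (-3 * (r x t) ^ 3 * q x t - 2 * ρ * (r x t) ^ 2) * dx q x t
      + 3 * ρ * (r x t) ^ 3 * (q x t) ^ 2
      + 4 * ρ ^ 2 * (r x t) ^ 2 * q x t
      + 8 * (-ρ ^ 3 + ρ ^ 2) * r x t = 0

/-- The reverse space-time reduction `r(x, t) = -q(-x, -t)`. -/
def reflect (q : Field) : Field := fun x t => -q (-x) (-t)

/-- `q` is a smooth solution, on a set `Ω` that is invariant under `(x, t) ↦ (-x, -t)`, of the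
reverse space-time nonlocal equation. -/
structure IsNonlocalSolution (ρ : ℝ) (Ω : Set (ℝ × ℝ)) (q : Field) : Prop where
  symm : ∀ x t, (x, t) ∈ Ω → (-x, -t) ∈ Ω
  smooth : Smooth Ω q
  eq : ∀ x t, (x, t) ∈ Ω →
    Complex.I * dt q x t + Complex.I * dx (dx (dx q)) x t
      - 3 * dx (fun y s => q y s * q (-y) (-s) * dx q y s
          + 1 / 2 * Complex.I * (q y s) ^ 3 * (q (-y) (-s)) ^ 2) x t
      + (2 * dx (dx q) x t - 3 * (q x t) ^ 3 * (q (-x) (-t)) ^ 2) * ρ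
      + (-2 * Complex.I * (q x t) ^ 2 * dx q (-x) (-t)
          + 10 * Complex.I * q x t * q (-x) (-t) * dx q x t) * ρ
      + (4 * (q x t) ^ 2 * q (-x) (-t) + 4 * Complex.I * dx q x t - 8 * q x t) * ρ ^ 2
      + 8 * q x t * ρ ^ 3 = 0

/-- The spatial Lax matrix `P` at spectral parameter `l`. -/
def laxP (ρ : ℝ) (q r : Field) (l : ℂ) (x t : ℝ) : Matrix (Fin 2) (Fin 2) ℂ :=
  !![-Complex.I / l ^ 2 + ρ * Complex.I, q x t / l;
     r x t / l, Complex.I / l ^ 2 - ρ * Complex.I]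

/-- The diagonal entry `Q₁` of the temporal Lax matrix. -/
def laxQ1 (ρ : ℝ) (q r : Field) (l : ℂ) (x t : ℝ) : ℂ :=
  -(3 * Complex.I * (q x t) ^ 2 * (r x t) ^ 2) / 2 * (l ^ 2)⁻¹
    - 4 * Complex.I * ρ ^ 2
    - dx r x t * q x t * (l ^ 2)⁻¹
    + dx q x t * r x t * (l ^ 2)⁻¹
    - 2 * Complex.I * q x t * r x t * (l ^ 4)⁻¹
    + 8 * Complex.I * ρ * (l ^ 4)⁻¹
    - 4 * Complex.I * (l ^ 6)⁻¹

/-- The upper right entry `Q₂` of the temporal Lax matrix. -/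
def laxQ2 (ρ : ℝ) (q r : Field) (l : ℂ) (x t : ℝ) : ℂ :=
  -dx (dx q) x t * l⁻¹
    + 3 * Complex.I * dx q x t * q x t * r x t * l⁻¹
    + 2 * Complex.I * dx q x t * (l ^ 3)⁻¹
    + 3 * (q x t) ^ 3 * (r x t) ^ 2 / 2 * l⁻¹
    + 2 * (q x t) ^ 2 * r x t * ρ * l⁻¹
    + 2 * (q x t) ^ 2 * r x t * (l ^ 3)⁻¹
    - 4 * q x t * ρ ^ 2 * l⁻¹
    - 4 * q x t * ρ * (l ^ 3)⁻¹
    + 4 * q x t * (l ^ 5)⁻¹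

/-- The lower left entry `Q₃` of the temporal Lax matrix. -/
def laxQ3 (ρ : ℝ) (q r : Field) (l : ℂ) (x t : ℝ) : ℂ :=
  -dx (dx r) x t * l⁻¹
    - 3 * Complex.I * dx r x t * q x t * r x t * l⁻¹
    - 2 * Complex.I * dx r x t * (l ^ 3)⁻¹
    + 3 * (q x t) ^ 2 * (r x t) ^ 3 / 2 * l⁻¹
    + 2 * q x t * (r x t) ^ 2 * ρ * l⁻¹
    + 2 * q x t * (r x t) ^ 2 * (l ^ 3)⁻¹
    - 4 * r x t * ρ ^ 2 * l⁻¹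
    - 4 * r x t * ρ * (l ^ 3)⁻¹
    + 4 * r x t * (l ^ 5)⁻¹

/-- The temporal Lax matrix `Q` at spectral parameter `l`. -/
def laxQ (ρ : ℝ) (q r : Field) (l : ℂ) (x t : ℝ) : Matrix (Fin 2) (Fin 2) ℂ :=
  !![laxQ1 ρ q r l x t, laxQ2 ρ q r l x t;
     laxQ3 ρ q r l x t, -laxQ1 ρ q r l x t]

/-- `(φ₁, φ₂)ᵀ` is a smooth eigenfunction on `Ω` of the Lax pair `Ψ_x = P Ψ`, `Ψ_t = Q Ψ`
at spectral parameter `l`. -/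
structure IsEigenfunction (ρ : ℝ) (Ω : Set (ℝ × ℝ)) (q r : Field) (l : ℂ)
    (φ₁ φ₂ : Field) : Prop where
  smooth₁ : Smooth Ω φ₁
  smooth₂ : Smooth Ω φ₂
  eq_x : ∀ x t, (x, t) ∈ Ω →
    ![dx φ₁ x t, dx φ₂ x t] = (laxP ρ q r l x t).mulVec ![φ₁ x t, φ₂ x t]
  eq_t : ∀ x t, (x, t) ∈ Ω →
    ![dt φ₁ x t, dt φ₂ x t] = (laxQ ρ q r l x t).mulVec ![φ₁ x t, φ₂ x t]

section Determinants

variable (N : ℕ) (lam : Fin (2 * N) → ℂ) (φ₁ φ₂ : Fin (2 * N) → Field)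

/-- The `2N × 2N` matrix whose `k`-th row is
`(λ_k^(2N-2) φ_{1,k}, λ_k^(2N-1) φ_{2,k}, λ_k^(2N-4) φ_{1,k}, λ_k^(2N-3) φ_{2,k}, …,
φ_{1,k}, λ_k φ_{2,k})`; columns are numbered from `0`. -/
def B12 (x t : ℝ) : Matrix (Fin (2 * N)) (Fin (2 * N)) ℂ :=
  Matrix.of fun k c =>
    if (c : ℕ) % 2 = 0 then lam k ^ (2 * N - 2 - (c : ℕ)) * φ₁ k x t
    else lam k ^ (2 * N - (c : ℕ)) * φ₂ k x t

/-- `B12` with its second column replaced by `-λ_k^(2N) φ_{1,k}`. -/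
def B11 (x t : ℝ) : Matrix (Fin (2 * N)) (Fin (2 * N)) ℂ :=
  Matrix.of fun k c =>
    if (c : ℕ) = 1 then -lam k ^ (2 * N) * φ₁ k x t else B12 N lam φ₁ φ₂ x t k c

/-- The `2N × 2N` matrix whose `k`-th row is
`(λ_k^(2N-1) φ_{1,k}, λ_k^(2N-2) φ_{2,k}, λ_k^(2N-3) φ_{1,k}, …, λ_k φ_{1,k}, φ_{2,k})`;
columns are numbered from `0`. -/
def B22 (x t : ℝ) : Matrix (Fin (2 * N)) (Fin (2 * N)) ℂ :=
  Matrix.of fun k c =>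
    lam k ^ (2 * N - 1 - (c : ℕ)) * (if (c : ℕ) % 2 = 0 then φ₁ k x t else φ₂ k x t)

/-- `B22` with its first column replaced by `-λ_k^(2N) φ_{2,k}`. -/
def B21 (x t : ℝ) : Matrix (Fin (2 * N)) (Fin (2 * N)) ℂ :=
  Matrix.of fun k c =>
    if (c : ℕ) = 0 then -lam k ^ (2 * N) * φ₂ k x t else B22 N lam φ₁ φ₂ x t k c

/-- `A_{2,N-1} = |B11| / |B12|`. -/
def A2top : Field := fun x t =>
  (B11 N lam φ₁ φ₂ x t).det / (B12 N lam φ₁ φ₂ x t).det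

/-- `A_{3,N-1} = |B21| / |B22|`. -/
def A3top : Field := fun x t =>
  (B21 N lam φ₁ φ₂ x t).det / (B22 N lam φ₁ φ₂ x t).det

/-- `q[N] = q - 2iρ A_{2,N-1} + ∂ₓ A_{2,N-1}`. -/
def qN (ρ : ℝ) (q : Field) : Field := fun x t =>
  q x t - 2 * Complex.I * ρ * A2top N lam φ₁ φ₂ x t + dx (A2top N lam φ₁ φ₂) x t

/-- `r[N] = r + 2iρ A_{3,N-1} + ∂ₓ A_{3,N-1}`. -/
def rN (ρ : ℝ) (r : Field) : Field := fun x t =>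
  r x t + 2 * Complex.I * ρ * A3top N lam φ₁ φ₂ x t + dx (A3top N lam φ₁ φ₂) x t

/-- The points of `Ω` at which both denominators `|B12|` and `|B22|` are nonzero. -/
def regularSet (Ω : Set (ℝ × ℝ)) : Set (ℝ × ℝ) :=
  {p | p ∈ Ω ∧ (B12 N lam φ₁ φ₂ p.1 p.2).det ≠ 0 ∧ (B22 N lam φ₁ φ₂ p.1 p.2).det ≠ 0}

end Determinants

/-- The Darboux matrix
`T(l) = [[l^(2N) + ∑ A_{1,j} l^(2j), ∑ A_{2,j} l^(2j+1)],
[∑ A_{3,j} l^(2j+1), l^(2N) + ∑ A_{4,j} l^(2j)]]`, all sums over `0 ≤ j ≤ N - 1`. -/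
def darbouxMatrix (N : ℕ) (A₁ A₂ A₃ A₄ : ℕ → Field) (l : ℂ) (x t : ℝ) :
    Matrix (Fin 2) (Fin 2) ℂ :=
  !![l ^ (2 * N) + ∑ j ∈ Finset.range N, A₁ j x t * l ^ (2 * j),
       ∑ j ∈ Finset.range N, A₂ j x t * l ^ (2 * j + 1);
     ∑ j ∈ Finset.range N, A₃ j x t * l ^ (2 * j + 1),
       l ^ (2 * N) + ∑ j ∈ Finset.range N, A₄ j x t * l ^ (2 * j)]

/-- Entrywise `x`-derivative of a matrix function. -/
def dxMat (T : ℝ → ℝ → Matrix (Fin 2) (Fin 2) ℂ) (x t : ℝ) : Matrix (Fin 2) (Fin 2) ℂ :=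
  Matrix.of fun i j => dx (fun y s => T y s i j) x t

/-- Entrywise `t`-derivative of a matrix function. -/
def dtMat (T : ℝ → ℝ → Matrix (Fin 2) (Fin 2) ℂ) (x t : ℝ) : Matrix (Fin 2) (Fin 2) ℂ :=
  Matrix.of fun i j => dt (fun y s => T y s i j) x t

/-- `T = darbouxMatrix N A₁ A₂ A₃ A₄`, with smooth coefficients on `Ω`, annihilates each
`(φ_{1,k}, φ_{2,k})ᵀ` at `l = λ_k`, and the gauge transformation `Ψ ↦ T Ψ` turns the Lax pair
of `(q, r)` into the Lax pair of `(q', r')` at every spectral parameter `l ≠ 0`: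
`T_x + T P = P' T` and `T_t + T Q = Q' T`. -/
structure IsDarbouxMatrix (ρ : ℝ) (Ω : Set (ℝ × ℝ)) (N : ℕ) (lam : Fin (2 * N) → ℂ)
    (φ₁ φ₂ : Fin (2 * N) → Field) (q r q' r' : Field) (A₁ A₂ A₃ A₄ : ℕ → Field) : Prop where
  smooth : ∀ j < N, Smooth Ω (A₁ j) ∧ Smooth Ω (A₂ j) ∧ Smooth Ω (A₃ j) ∧ Smooth Ω (A₄ j)
  kernel : ∀ k x t, (x, t) ∈ Ω →
    (darbouxMatrix N A₁ A₂ A₃ A₄ (lam k) x t).mulVec ![φ₁ k x t, φ₂ k x t] = 0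
  gauge_x : ∀ l : ℂ, l ≠ 0 → ∀ x t, (x, t) ∈ Ω →
    dxMat (darbouxMatrix N A₁ A₂ A₃ A₄ l) x t
        + darbouxMatrix N A₁ A₂ A₃ A₄ l x t * laxP ρ q r l x t
      = laxP ρ q' r' l x t * darbouxMatrix N A₁ A₂ A₃ A₄ l x t
  gauge_t : ∀ l : ℂ, l ≠ 0 → ∀ x t, (x, t) ∈ Ω →
    dtMat (darbouxMatrix N A₁ A₂ A₃ A₄ l) x t
        + darbouxMatrix N A₁ A₂ A₃ A₄ l x t * laxQ ρ q r l x t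
      = laxQ ρ q' r' l x t * darbouxMatrix N A₁ A₂ A₃ A₄ l x t

end SelfSteepening

end

/-!
The argument is algebraic and takes place over the differential ring `K` of smooth functions on the
set of regular points. After conjugation by `diag(1, l)` the Darboux matrix and, up to a power of
`l²`, both Lax matrices are polynomial in `X = l²`. The Darboux matrix `T` is then the matrix with
rows `(X ^ N + a, b)` and `(X c, X ^ N + d)`, where `a, b, c, d` have degree less than `N` and the
rows annihilate the `2N` vectors `(φ₁, l φ₂)ᵀ` at the nodes `X = λ_k²`. Both rows are solutions of
linear systems with matrices `B12` and `B22`; Cramer's rule gives the top coefficients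
`A_{2,N-1}` and `A_{3,N-1}` (`coeff_b_mul_det`, `coeff_c_mul_det`).

The nodes may coincide and `det T` is not computed. Instead, unique solvability of the two systems
shows by division with remainder that every row of polynomials annihilating the vectors is a
combination of the rows of `T` (`IsDarbouxPolynomial.exists_combination`). Since the vectors solve
the Lax equations, the rows of `Xˢ T' + T L` are annihilating rows, so `Xˢ T' + T L = M T` for a
polynomial matrix `M` of the same degree as `L` (`IsDarbouxPolynomial.exists_isGauge`). It remains
to identify `M`. Unique solvability also makes `det T` invertible at `X = 0`, so `det T` can be
cancelled. This fixes the extreme coefficients of `M`, its trace, and its determinant modulo `Xˢ`.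
For the spatial matrix the extreme coefficients already give the form `P(q[N], r[N])`. For the
temporal matrix, `M` has zero curvature together with the transformed spatial matrix, since gauge
transformations preserve curvature. Comparing coefficients in the zero curvature equation, where
the determinant supplies the integration constants, determines `M` to be `Q(q[N], r[N])`, and the
coefficients that are left over are the coupled system for `(q[N], r[N])`
(`eq_polyQ_of_curvature_eq_zero`).

For the nonlocal equation, `r(x, t) = -q(-x, -t)` turns the coupled system into that equation
(`isNonlocalSolution_iff`), and reflection interchanges `B12` with `B22` and `B11` with `B21` up to
one and the same permutation of columns. Hence `A_{2,N-1}(-x, -t) = A_{3,N-1}(x, t)`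
(`A2top_neg`), and the transformation preserves the reduction (`rN_reflect`).
-/

namespace SelfSteepening

open Polynomial

/-! ### Annihilating rows and the polynomial Darboux matrix -/

lemma mem_degreeLT_iff_coeff {K : Type*} [CommRing K] {p : K[X]} {n : ℕ} :
    p ∈ degreeLT K n ↔ ∀ m, n ≤ m → p.coeff m = 0 := by
  rw [mem_degreeLT, degree_lt_iff_coeff_zero]

section Coefficientwise

variable {K : Type*} [CommRing K] [Algebra ℂ K]

/-- The extension of a derivation of `K` to `K[X]` with `X ↦ 0`. -/
noncomputable def coeffwise (D : Derivation ℂ K K) : Derivation ℂ K[X] K[X] :=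
  Derivation.mk'
    { toFun := fun p => PolynomialModule.equivPolynomialSelf (D.mapCoeffs p)
      map_add' := fun p q => by simp
      map_smul' := fun c p => by
        ext n
        change D ((c • p).coeff n) = (c • _ : K[X]).coeff n
        rw [coeff_smul, coeff_smul, D.map_smul]; rfl }
    (fun p q => by
      change PolynomialModule.equivPolynomialSelf (D.mapCoeffs (p * q)) = _
      rw [Derivation.leibniz, map_add, map_smul, map_smul]; rfl)

variable (D E : Derivation ℂ K K)

@[simp]
lemma coeff_coeffwise (p : K[X]) (n : ℕ) : (coeffwise D p).coeff n = D (p.coeff n) := rfl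

@[simp]
lemma coeffwise_C (a : K) : coeffwise D (C a) = C (D a) := by
  ext n; simp only [coeff_coeffwise, coeff_C]; split_ifs <;> simp

@[simp]
lemma coeffwise_X : coeffwise D (X : K[X]) = 0 := by
  ext n; simp only [coeff_coeffwise, coeff_X]; split_ifs <;> simp

@[simp]
lemma coeffwise_mul (p r : K[X]) :
    coeffwise D (p * r) = p * coeffwise D r + r * coeffwise D p := by
  simp [Derivation.leibniz]

lemma coeffwise_X_pow (n : ℕ) : coeffwise D ((X : K[X]) ^ n) = 0 := by
  simp [Derivation.leibniz_pow]

lemma eval_coeffwise {m : K} (hm : D m = 0) (p : K[X]) :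
    (coeffwise D p).eval m = D (p.eval m) := by
  induction p using Polynomial.induction_on' with
  | add p q hp hq => simp [hp, hq]
  | monomial n a =>
    rw [← C_mul_X_pow_eq_monomial, coeffwise_mul, coeffwise_X_pow]
    simp only [coeffwise_C, mul_zero, zero_add, eval_mul, eval_pow, eval_X, eval_C,
      Derivation.leibniz, Derivation.leibniz_pow, hm, smul_zero, smul_eq_mul]

lemma coeffwise_comm (h : ∀ a, D (E a) = E (D a)) (p : K[X]) :
    coeffwise D (coeffwise E p) = coeffwise E (coeffwise D p) := by
  ext n; simp [h]

lemma coeffwise_mem_degreeLT {p : K[X]} {n : ℕ} (h : p ∈ degreeLT K n) :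
    coeffwise D p ∈ degreeLT K n := by
  rw [mem_degreeLT_iff_coeff] at h ⊢
  intro m hm
  simp [h m hm]

end Coefficientwise

section DarbouxAlgebra

variable {K : Type*} [CommRing K] {ι : Type*}

/-- A pair of polynomials `(a, b)`, read as a row vector depending on the spectral parameter,
annihilates each vector `(u k, v k)ᵀ` at the node `m k`. -/
def Annihilates (m u v : ι → K) (a b : K[X]) : Prop :=
  ∀ k, a.eval (m k) * u k + b.eval (m k) * v k = 0

/-- Unique solvability of the two interpolation problems of degree less than `N` that define the
Darboux matrix: rows `(a, b)` and rows `(X a, b)` are determined by arbitrary prescribed values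
at the nodes. -/
structure IsUnisolvent (N : ℕ) (m u v : ι → K) : Prop where
  isUnit_node : ∀ k, IsUnit (m k)
  inj₁ : ∀ a b : K[X], a ∈ degreeLT K N → b ∈ degreeLT K N → Annihilates m u v a b →
    a = 0 ∧ b = 0
  surj₁ : ∀ w : ι → K, ∃ a b : K[X], a ∈ degreeLT K N ∧ b ∈ degreeLT K N ∧
    ∀ k, a.eval (m k) * u k + b.eval (m k) * v k = w k
  inj₂ : ∀ a b : K[X], a ∈ degreeLT K N → b ∈ degreeLT K N → Annihilates m u v (X * a) b →
    a = 0 ∧ b = 0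
  surj₂ : ∀ w : ι → K, ∃ a b : K[X], a ∈ degreeLT K N ∧ b ∈ degreeLT K N ∧
    ∀ k, m k * a.eval (m k) * u k + b.eval (m k) * v k = w k

/-- The polynomials `a, b, c, d` of degree less than `N` are those of the Darboux matrix: its rows,
after conjugation by `diag(1, l)` and with `X = l²`, are `(X ^ N + a, b)` and
`(X c, X ^ N + d)`, and they annihilate the vectors `(u k, v k)ᵀ` at the nodes. -/
structure IsDarbouxPolynomial (N : ℕ) (m u v : ι → K) (a b c d : K[X]) : Prop where
  deg_a : a ∈ degreeLT K N
  deg_b : b ∈ degreeLT K N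
  deg_c : c ∈ degreeLT K N
  deg_d : d ∈ degreeLT K N
  row₁ : Annihilates m u v (X ^ N + a) b
  row₂ : Annihilates m u v (X * c) (X ^ N + d)

lemma Annihilates.sub_mul {m u v : ι → K} {a b a' b' : K[X]} (h : Annihilates m u v a b)
    (h' : Annihilates m u v a' b') (p : K[X]) :
    Annihilates m u v (a - p * a') (b - p * b') := by
  intro k
  simp only [eval_sub, eval_mul]
  linear_combination h k - p.eval (m k) * h' k

lemma IsUnisolvent.exists_isDarbouxPolynomial {N : ℕ} {m u v : ι → K}
    (h : IsUnisolvent N m u v) : ∃ a b c d, IsDarbouxPolynomial N m u v a b c d := by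
  obtain ⟨a, b, ha, hb, hab⟩ := h.surj₁ fun k => -(m k ^ N * u k)
  obtain ⟨c, d, hc, hd, hcd⟩ := h.surj₂ fun k => -(m k ^ N * v k)
  refine ⟨a, b, c, d, ha, hb, hc, hd, fun k => ?_, fun k => ?_⟩
  · simp only [eval_add, eval_pow, eval_X]
    linear_combination hab k
  · simp only [eval_add, eval_pow, eval_X, eval_mul]
    linear_combination hcd k

lemma C_mul_mem_degreeLT {p : K[X]} {n : ℕ} (y : K) (h : p ∈ degreeLT K n) :
    C y * p ∈ degreeLT K n := by
  rw [← smul_eq_C_mul]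
  exact Submodule.smul_mem _ _ h

lemma C_mem_degreeLT (y : K) {n : ℕ} (hn : 0 < n) : C y ∈ degreeLT K n := by
  rw [mem_degreeLT_iff_coeff]
  intro k hk
  rw [coeff_C, if_neg (by omega)]

lemma X_pow_add_mem_degreeLT {a : K[X]} {N : ℕ} (ha : a ∈ degreeLT K N) :
    X ^ N + a ∈ degreeLT K (N + 1) := by
  rw [mem_degreeLT_iff_coeff] at ha ⊢
  intro m hm
  rw [coeff_add, coeff_X_pow, if_neg (by omega), ha m (by omega), add_zero]

lemma X_mul_mem_degreeLT {a : K[X]} {N : ℕ} (ha : a ∈ degreeLT K N) :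
    X * a ∈ degreeLT K (N + 1) := by
  rw [mem_degreeLT_iff_coeff] at ha ⊢
  rintro (_ | m) hm
  · omega
  · rw [coeff_X_mul, ha m (by omega)]

lemma coeff_X_pow_add {a : K[X]} {N : ℕ} (ha : a ∈ degreeLT K N) :
    (X ^ N + a).coeff N = 1 := by
  rw [mem_degreeLT_iff_coeff] at ha
  simp [ha N le_rfl]

lemma exists_eq_X_mul {p : K[X]} {n : ℕ} (h : p ∈ degreeLT K (n + 1)) (h0 : p.coeff 0 = 0) :
    ∃ p' : K[X], p = X * p' ∧ p' ∈ degreeLT K n := by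
  refine ⟨p.divX, ?_, ?_⟩
  · have := X_mul_divX_add p
    simpa [h0] using this.symm
  · rw [mem_degreeLT_iff_coeff] at h ⊢
    intro m hm
    rw [coeff_divX]
    exact h _ (by omega)

variable {N : ℕ} {m u v : ι → K} {a b c d : K[X]}

/-- The constant coefficient of the upper left entry is invertible: removing it from the first
row leaves `X` times a solution of the second interpolation problem with leading coefficient `1`,
and that solution is a multiple of the constant coefficient. -/
lemma IsDarbouxPolynomial.isUnit_coeff_a (hN : 0 < N) (hu : IsUnisolvent N m u v)
    (h : IsDarbouxPolynomial N m u v a b c d) : IsUnit ((X ^ N + a).coeff 0) := by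
  set y := (X ^ N + a).coeff 0 with hy
  obtain ⟨p, hp, hpdeg⟩ := exists_eq_X_mul (p := X ^ N + a - C y) (n := N)
    (sub_mem (X_pow_add_mem_degreeLT h.deg_a) (C_mem_degreeLT _ (by omega)))
    (by rw [coeff_sub, coeff_C_zero, hy, sub_self])
  obtain ⟨r, s, hr, hs, hrs⟩ := hu.surj₂ fun k => u k
  obtain ⟨key, -⟩ := hu.inj₂ (C y * r + p) (C y * s + b)
    (add_mem (C_mul_mem_degreeLT _ hr) hpdeg) (add_mem (C_mul_mem_degreeLT _ hs) h.deg_b)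
    (fun k => by
      have h1 := h.row₁ k
      rw [sub_eq_iff_eq_add.mp hp] at h1
      simp only [eval_add, eval_mul, eval_C, eval_X] at h1 ⊢
      linear_combination h1 + y * hrs k)
  obtain ⟨n, rfl⟩ : ∃ n, N = n + 1 := ⟨N - 1, by omega⟩
  have h2 := congrArg (fun f => coeff f (n + 1)) hp
  simp only [coeff_sub, coeff_X_pow_add h.deg_a, coeff_C_succ, coeff_X_mul] at h2
  have h3 := congrArg (fun f => coeff f n) key
  simp only [coeff_add, coeff_C_mul, coeff_zero] at h3
  exact .of_mul_eq_one (-r.coeff n) (by linear_combination -h3 - h2)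

/-- The constant coefficient of the lower right entry is invertible, by the same argument with the
two interpolation problems interchanged. -/
lemma IsDarbouxPolynomial.isUnit_coeff_d (hN : 0 < N) (hu : IsUnisolvent N m u v)
    (h : IsDarbouxPolynomial N m u v a b c d) : IsUnit ((X ^ N + d).coeff 0) := by
  set y := (X ^ N + d).coeff 0 with hy
  obtain ⟨p, hp, hpdeg⟩ := exists_eq_X_mul (p := X ^ N + d - C y) (n := N)
    (sub_mem (X_pow_add_mem_degreeLT h.deg_d) (C_mem_degreeLT _ (by omega)))
    (by rw [coeff_sub, coeff_C_zero, hy, sub_self])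
  choose e he using fun k => (hu.isUnit_node k).exists_right_inv
  obtain ⟨r, s, hr, hs, hrs⟩ := hu.surj₁ fun k => e k * v k
  obtain ⟨-, key⟩ := hu.inj₁ (C y * r + c) (C y * s + p)
    (add_mem (C_mul_mem_degreeLT _ hr) h.deg_c) (add_mem (C_mul_mem_degreeLT _ hs) hpdeg)
    (fun k => by
      have h1 := h.row₂ k
      rw [sub_eq_iff_eq_add.mp hp] at h1
      simp only [eval_add, eval_mul, eval_C, eval_X] at h1 ⊢
      refine (hu.isUnit_node k).mul_left_cancel ?_
      linear_combination h1 + y * m k * hrs k + y * v k * he k)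
  obtain ⟨n, rfl⟩ : ∃ n, N = n + 1 := ⟨N - 1, by omega⟩
  have h2 := congrArg (fun f => coeff f (n + 1)) hp
  simp only [coeff_sub, coeff_X_pow_add h.deg_d, coeff_C_succ, coeff_X_mul] at h2
  have h3 := congrArg (fun f => coeff f n) key
  simp only [coeff_add, coeff_C_mul, coeff_zero] at h3
  exact .of_mul_eq_one (-s.coeff n) (by linear_combination -h3 - h2)

/-- The two rows of the Darboux matrix generate all annihilating rows: division with remainder
leaves a solution of the homogeneous interpolation problem. -/
lemma IsDarbouxPolynomial.exists_combination (hu : IsUnisolvent N m u v)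
    (h : IsDarbouxPolynomial N m u v a b c d) (n : ℕ) : ∀ p r : K[X],
    p ∈ degreeLT K (N + n) → r ∈ degreeLT K (N + n) → Annihilates m u v p r →
    ∃ α β, α ∈ degreeLT K n ∧ β ∈ degreeLT K n ∧
      p = α * (X ^ N + a) + β * (X * c) ∧ r = α * b + β * (X ^ N + d) := by
  induction n with
  | zero =>
    intro p r hp hr hpr
    obtain ⟨rfl, rfl⟩ := hu.inj₁ p r hp hr hpr
    exact ⟨0, 0, zero_mem _, zero_mem _, by simp, by simp⟩
  | succ n ih =>
    have key : ∀ {p t : K[X]} {k j : ℕ}, k + j = N + n → p ∈ degreeLT K (N + (n + 1)) →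
        t ∈ degreeLT K (k + 1) → ∀ y, (p - C y * X ^ j * t) ∈ degreeLT K (N + (n + 1)) := by
      intro p t k j hk hp ht y
      refine sub_mem hp ?_
      rw [mem_degreeLT_iff_coeff] at ht ⊢
      intro i hi
      rw [mul_assoc, coeff_C_mul, coeff_X_pow_mul', if_pos (by omega), ht _ (by omega), mul_zero]
    have drop : ∀ {p : K[X]}, p ∈ degreeLT K (N + (n + 1)) → p.coeff (N + n) = 0 →
        p ∈ degreeLT K (N + n) := by
      intro p hp h0
      rw [mem_degreeLT_iff_coeff] at hp ⊢
      intro i hi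
      rcases hi.eq_or_lt with rfl | hi
      · exact h0
      · exact hp i (by omega)
    intro p r hp hr hpr
    -- the second row first: it changes the top coefficient of `p`, but the first row does not
    -- change that of `r`
    set y := r.coeff (N + n)
    have hc := X_mul_mem_degreeLT h.deg_c
    have hp1 := key (k := N) (j := n) rfl hp hc y
    have hr1 := key (k := N) (j := n) rfl hr (X_pow_add_mem_degreeLT h.deg_d) y
    have h1 := hpr.sub_mul h.row₂ (C y * X ^ n)
    set p1 := p - C y * X ^ n * (X * c)
    set r1 := r - C y * X ^ n * (X ^ N + d) with hr1_def
    have hr1top : r1.coeff (N + n) = 0 := by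
      rw [hr1_def, coeff_sub, mul_assoc, coeff_C_mul, coeff_X_pow_mul,
        coeff_X_pow_add h.deg_d, mul_one, sub_self]
    set z := p1.coeff (N + n)
    have hp2 := key (k := N) (j := n) rfl hp1 (X_pow_add_mem_degreeLT h.deg_a) z
    have hr2 := key (k := N) (j := n) rfl hr1 (degreeLT_mono (Nat.le_succ N) h.deg_b) z
    have h2 := h1.sub_mul h.row₁ (C z * X ^ n)
    obtain ⟨α, β, hα, hβ, e1, e2⟩ := ih _ _
      (drop hp2 (by rw [coeff_sub, mul_assoc, coeff_C_mul, coeff_X_pow_mul,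
        coeff_X_pow_add h.deg_a, mul_one, sub_self]))
      (drop hr2 (by rw [coeff_sub, mul_assoc, coeff_C_mul, coeff_X_pow_mul, hr1top,
        mem_degreeLT_iff_coeff.mp h.deg_b N le_rfl, mul_zero, sub_self])) h2
    have top : ∀ y : K, C y * X ^ n ∈ degreeLT K (n + 1) := by
      intro y
      rw [mem_degreeLT_iff_coeff]
      intro i hi
      rw [coeff_C_mul, coeff_X_pow, if_neg (by omega), mul_zero]
    refine ⟨α + C z * X ^ n, β + C y * X ^ n,
      add_mem (degreeLT_mono (Nat.le_succ n) hα) (top _),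
      add_mem (degreeLT_mono (Nat.le_succ n) hβ) (top _), ?_, ?_⟩
    · linear_combination e1
    · linear_combination e2

/-- The Darboux matrix conjugated by `diag(1, l)`, as a polynomial matrix in `X = l²`. -/
noncomputable def darbouxPoly (N : ℕ) (a b c d : K[X]) : Matrix (Fin 2) (Fin 2) K[X] :=
  !![X ^ N + a, b; X * c, X ^ N + d]

lemma mem_degreeLT_succ_iff_natDegree_le {p : K[X]} {n : ℕ} :
    p ∈ degreeLT K (n + 1) ↔ p.natDegree ≤ n := by
  rw [mem_degreeLT_iff_coeff, natDegree_le_iff_coeff_eq_zero]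
  rfl

lemma mul_mem_degreeLT {p r : K[X]} {i j : ℕ} (hp : p ∈ degreeLT K (i + 1))
    (hr : r ∈ degreeLT K (j + 1)) : p * r ∈ degreeLT K (i + j + 1) := by
  rw [mem_degreeLT_succ_iff_natDegree_le] at *
  exact natDegree_mul_le_of_le hp hr

lemma coeff_mul_of_mem_degreeLT {p r : K[X]} {i j : ℕ} (hp : p ∈ degreeLT K (i + 1))
    (hr : r ∈ degreeLT K (j + 1)) : (p * r).coeff (i + j) = p.coeff i * r.coeff j := by
  rw [mem_degreeLT_succ_iff_natDegree_le] at *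
  exact coeff_mul_add_eq_of_natDegree_le hp hr

lemma IsDarbouxPolynomial.mem_degreeLT (h : IsDarbouxPolynomial N m u v a b c d) (i j : Fin 2) :
    darbouxPoly N a b c d i j ∈ degreeLT K (N + 1) := by
  fin_cases i <;> fin_cases j
  · exact X_pow_add_mem_degreeLT h.deg_a
  · exact degreeLT_mono (Nat.le_succ N) h.deg_b
  · exact X_mul_mem_degreeLT h.deg_c
  · exact X_pow_add_mem_degreeLT h.deg_d

/-- The determinant of the Darboux matrix has invertible constant coefficient, so it may be
cancelled in divisibility statements by powers of `X`. -/
lemma IsDarbouxPolynomial.X_pow_dvd_of_mul_det (hN : 0 < N) (hun : IsUnisolvent N m u v)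
    (h : IsDarbouxPolynomial N m u v a b c d) {p : K[X]} {n : ℕ}
    (hp : X ^ n ∣ p * (darbouxPoly N a b c d).det) : X ^ n ∣ p := by
  have hunit : IsUnit ((darbouxPoly N a b c d).det.coeff 0) := by
    have := (h.isUnit_coeff_a hN hun).mul (h.isUnit_coeff_d hN hun)
    simpa [Matrix.det_fin_two, darbouxPoly, mul_coeff_zero] using this
  obtain ⟨y, hy⟩ := hunit.exists_right_inv
  refine IsCoprime.dvd_of_dvd_mul_right (IsCoprime.pow_left ?_) hp
  generalize (darbouxPoly N a b c d).det = δ at *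
  refine ⟨-(C y * δ.divX), C y, ?_⟩
  have h1 := X_mul_divX_add δ
  have h2 : C (δ.coeff 0) * C y = 1 := by rw [← C_mul, hy, C_1]
  linear_combination -C y * h1 + h2

/-- A polynomial divisible by every power of `X` vanishes, so `det T` can be cancelled. -/
lemma IsDarbouxPolynomial.eq_zero_of_mul_det (hN : 0 < N) (hun : IsUnisolvent N m u v)
    (h : IsDarbouxPolynomial N m u v a b c d) {p : K[X]}
    (hp : p * (darbouxPoly N a b c d).det = 0) : p = 0 := by
  ext n
  exact X_pow_dvd_iff.mp
    (h.X_pow_dvd_of_mul_det hN hun (n := n + 1) (hp ▸ dvd_zero _)) n (Nat.lt_succ_self n)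

end DarbouxAlgebra

/-! ### Gauge transformations by the Darboux matrix -/

section Gauge

variable {K : Type*} [CommRing K] [Algebra ℂ K] {ι : Type*}
variable {N : ℕ} {m u v : ι → K} {a b c d : K[X]}

/-- The gauge relation `D T + T (X⁻ˢ L) = (X⁻ˢ M) T` for a Lax matrix `X⁻ˢ L`, with denominators
cleared. -/
def IsGauge (D : Derivation ℂ K K) (s : ℕ) (T L M : Matrix (Fin 2) (Fin 2) K[X]) : Prop :=
  ∀ i j, X ^ s * coeffwise D (T i j) + (T i 0 * L 0 j + T i 1 * L 1 j)
    = M i 0 * T 0 j + M i 1 * T 1 j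

/-- If the vectors `(u k, v k)ᵀ` solve the linear equation with matrix `X⁻ˢ L` at the nodes, then
differentiating an annihilating row `w` gives the annihilating row `Xˢ D w + w L`. -/
lemma Annihilates.lax {D : Derivation ℂ K K} {s : ℕ} {L : Matrix (Fin 2) (Fin 2) K[X]}
    (hm : ∀ k, D (m k) = 0)
    (hu : ∀ k, m k ^ s * D (u k) = (L 0 0).eval (m k) * u k + (L 0 1).eval (m k) * v k)
    (hv : ∀ k, m k ^ s * D (v k) = (L 1 0).eval (m k) * u k + (L 1 1).eval (m k) * v k)
    {p r : K[X]} (h : Annihilates m u v p r) :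
    Annihilates m u v (X ^ s * coeffwise D p + (p * L 0 0 + r * L 1 0))
      (X ^ s * coeffwise D r + (p * L 0 1 + r * L 1 1)) := by
  intro k
  have h1 := congrArg D (h k)
  simp only [map_add, Derivation.leibniz, smul_eq_mul, map_zero] at h1
  simp only [eval_add, eval_mul, eval_pow, eval_X, eval_coeffwise D (hm k)]
  linear_combination m k ^ s * h1 - p.eval (m k) * hu k - r.eval (m k) * hv k

/-- The Darboux matrix transforms a Lax matrix `X⁻ˢ L` with `L` of degree at most `s` into one of
the same form: the rows of `Xˢ D T + T L` annihilate the vectors `(u k, v k)ᵀ`, so they are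
combinations of the rows of `T`. -/
lemma IsDarbouxPolynomial.exists_isGauge {D : Derivation ℂ K K} {s : ℕ}
    {L : Matrix (Fin 2) (Fin 2) K[X]} (hun : IsUnisolvent N m u v)
    (h : IsDarbouxPolynomial N m u v a b c d) (hm : ∀ k, D (m k) = 0)
    (hu : ∀ k, m k ^ s * D (u k) = (L 0 0).eval (m k) * u k + (L 0 1).eval (m k) * v k)
    (hv : ∀ k, m k ^ s * D (v k) = (L 1 0).eval (m k) * u k + (L 1 1).eval (m k) * v k)
    (hL : ∀ i j, L i j ∈ degreeLT K (s + 1)) :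
    ∃ M : Matrix (Fin 2) (Fin 2) K[X], (∀ i j, M i j ∈ degreeLT K (s + 1)) ∧
      IsGauge D s (darbouxPoly N a b c d) L M := by
  have hT := h.mem_degreeLT
  have hdeg : ∀ i j, X ^ s * coeffwise D (darbouxPoly N a b c d i j) +
      (darbouxPoly N a b c d i 0 * L 0 j + darbouxPoly N a b c d i 1 * L 1 j)
        ∈ degreeLT K (N + (s + 1)) := by
    intro i j
    refine add_mem ?_ (add_mem (mul_mem_degreeLT (hT _ _) (hL _ _))
      (mul_mem_degreeLT (hT _ _) (hL _ _)))
    have := coeffwise_mem_degreeLT D (hT i j)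
    rw [mem_degreeLT_iff_coeff] at this ⊢
    intro n hn
    rw [coeff_X_pow_mul', if_pos (by omega), this _ (by omega)]
  obtain ⟨α₀, β₀, hα₀, hβ₀, e00, e01⟩ := h.exists_combination hun (s + 1) _ _
    (hdeg 0 0) (hdeg 0 1) (h.row₁.lax hm hu hv)
  obtain ⟨α₁, β₁, hα₁, hβ₁, e10, e11⟩ := h.exists_combination hun (s + 1) _ _
    (hdeg 1 0) (hdeg 1 1) (h.row₂.lax hm hu hv)
  refine ⟨!![α₀, β₀; α₁, β₁], ?_, ?_⟩
  · rw [Fin.forall_fin_two, Fin.forall_fin_two, Fin.forall_fin_two]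
    exact ⟨⟨hα₀, hβ₀⟩, hα₁, hβ₁⟩
  · unfold IsGauge
    rw [Fin.forall_fin_two, Fin.forall_fin_two, Fin.forall_fin_two]
    exact ⟨⟨e00, e01⟩, e10, e11⟩

/-- The extreme coefficients of the transformed Lax matrix: the diagonal is that of the original
one, the lowest coefficient is upper triangular, and the highest is lower triangular. -/
lemma IsDarbouxPolynomial.extreme_coeff (hN : 0 < N) {D : Derivation ℂ K K} {s : ℕ} (hs : 0 < s)
    {L M : Matrix (Fin 2) (Fin 2) K[X]} (hun : IsUnisolvent N m u v)
    (h : IsDarbouxPolynomial N m u v a b c d)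
    (hL : ∀ i j, L i j ∈ degreeLT K (s + 1)) (hM : ∀ i j, M i j ∈ degreeLT K (s + 1))
    (hg : IsGauge D s (darbouxPoly N a b c d) L M)
    (hL0 : (L 1 0).coeff 0 = 0) (hLs : (L 0 1).coeff s = 0) :
    (M 0 0).coeff 0 = (L 0 0).coeff 0 ∧ (M 1 0).coeff 0 = 0 ∧
      (M 1 1).coeff 0 = (L 1 1).coeff 0 ∧
    (M 0 0).coeff s = (L 0 0).coeff s ∧ (M 0 1).coeff s = 0 ∧
      (M 1 1).coeff s = (L 1 1).coeff s := by
  have ua : IsUnit ((darbouxPoly N a b c d 0 0).coeff 0) := h.isUnit_coeff_a hN hun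
  have ud : IsUnit ((darbouxPoly N a b c d 1 1).coeff 0) := h.isUnit_coeff_d hN hun
  have t10 : (darbouxPoly N a b c d 1 0).coeff 0 = 0 := by simp [darbouxPoly]
  have t00 : (darbouxPoly N a b c d 0 0).coeff N = 1 := coeff_X_pow_add h.deg_a
  have t01 : (darbouxPoly N a b c d 0 1).coeff N = 0 :=
    mem_degreeLT_iff_coeff.mp h.deg_b N le_rfl
  have t11 : (darbouxPoly N a b c d 1 1).coeff N = 1 := coeff_X_pow_add h.deg_d
  have hT := h.mem_degreeLT
  generalize darbouxPoly N a b c d = T at *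
  have low : ∀ i j, (T i 0).coeff 0 * (L 0 j).coeff 0 + (T i 1).coeff 0 * (L 1 j).coeff 0
      = (M i 0).coeff 0 * (T 0 j).coeff 0 + (M i 1).coeff 0 * (T 1 j).coeff 0 := by
    intro i j
    have := congrArg (fun f => coeff f 0) (hg i j)
    simpa only [coeff_add, mul_coeff_zero, coeff_X_pow, if_neg hs.ne, zero_mul, zero_add] using this
  have high : ∀ i j, D ((T i j).coeff N) +
      ((T i 0).coeff N * (L 0 j).coeff s + (T i 1).coeff N * (L 1 j).coeff s)
      = (M i 0).coeff s * (T 0 j).coeff N + (M i 1).coeff s * (T 1 j).coeff N := by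
    intro i j
    have := congrArg (fun f => coeff f (N + s)) (hg i j)
    simp only [coeff_add, coeff_X_pow_mul, coeff_coeffwise,
      coeff_mul_of_mem_degreeLT (hT _ _) (hL _ _)] at this
    rw [this, add_comm N s, coeff_mul_of_mem_degreeLT (hM _ _) (hT _ _),
      coeff_mul_of_mem_degreeLT (hM _ _) (hT _ _)]
  have l00 := low 0 0
  have l10 := low 1 0
  have l11 := low 1 1
  have h00 := high 0 0
  have h01 := high 0 1
  have h11 := high 1 1
  simp only [t10, hL0, t00, t01, t11, hLs, Derivation.map_one_eq_zero, map_zero, mul_zero,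
    zero_mul, add_zero, zero_add, one_mul, mul_one] at l00 l10 l11 h00 h01 h11
  have m10 : (M 1 0).coeff 0 = 0 := ua.mul_left_eq_zero.mp l10.symm
  rw [← h01, zero_mul, add_zero] at h00
  rw [m10, zero_mul, zero_add, mul_comm] at l11
  rw [mul_comm] at l00
  exact ⟨(ua.mul_right_cancel l00).symm, m10, (ud.mul_right_cancel l11).symm, h00.symm, h01.symm,
    h11.symm⟩

/-- The transformed Lax matrix is traceless: its trace times `det T` is `X ^ s D (det T)`, so that
the trace is a multiple of `X ^ s`, and its coefficient of `X ^ s` vanishes. -/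
lemma IsDarbouxPolynomial.trace_eq_zero (hN : 0 < N) {D : Derivation ℂ K K} {s : ℕ} (hs : 0 < s)
    {L M : Matrix (Fin 2) (Fin 2) K[X]} (hun : IsUnisolvent N m u v)
    (h : IsDarbouxPolynomial N m u v a b c d)
    (hL : ∀ i j, L i j ∈ degreeLT K (s + 1)) (hM : ∀ i j, M i j ∈ degreeLT K (s + 1))
    (hg : IsGauge D s (darbouxPoly N a b c d) L M)
    (hL0 : (L 1 0).coeff 0 = 0) (hLs : (L 0 1).coeff s = 0) (htr : L 0 0 + L 1 1 = 0) :
    M 0 0 + M 1 1 = 0 := by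
  obtain ⟨-, -, -, h0, -, h1⟩ := h.extreme_coeff hN hs hun hL hM hg hL0 hLs
  have hdvd : X ^ s ∣ M 0 0 + M 1 1 := by
    refine h.X_pow_dvd_of_mul_det hN hun ⟨coeffwise D (darbouxPoly N a b c d).det, ?_⟩
    rw [Matrix.det_fin_two]
    generalize darbouxPoly N a b c d = T at *
    rw [map_sub, coeffwise_mul, coeffwise_mul]
    linear_combination -(T 1 1) * hg 0 0 - T 0 0 * hg 1 1 + T 1 0 * hg 0 1 + T 0 1 * hg 1 0
      + (T 0 0 * T 1 1 - T 0 1 * T 1 0) * htr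
  ext n
  rcases lt_trichotomy n s with hn | rfl | hn
  · exact X_pow_dvd_iff.mp hdvd n hn
  · rw [coeff_add, h0, h1, ← coeff_add, htr]
  · rw [coeff_add, mem_degreeLT_iff_coeff.mp (hM 0 0) n hn,
      mem_degreeLT_iff_coeff.mp (hM 1 1) n hn, add_zero, coeff_zero]

/-- Modulo `X ^ s` the transformed Lax matrix has the determinant of the original one. -/
lemma IsDarbouxPolynomial.X_pow_dvd_det_sub (hN : 0 < N) {D : Derivation ℂ K K} {s : ℕ}
    {L M : Matrix (Fin 2) (Fin 2) K[X]} (hun : IsUnisolvent N m u v)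
    (h : IsDarbouxPolynomial N m u v a b c d) (hg : IsGauge D s (darbouxPoly N a b c d) L M) :
    X ^ s ∣ M.det - L.det := by
  refine h.X_pow_dvd_of_mul_det hN hun ?_
  rw [Matrix.det_fin_two, Matrix.det_fin_two, Matrix.det_fin_two]
  generalize darbouxPoly N a b c d = T at *
  have e : ∀ i j, M i 0 * T 0 j + M i 1 * T 1 j - X ^ s * coeffwise D (T i j)
      = T i 0 * L 0 j + T i 1 * L 1 j := fun i j => by linear_combination -hg i j
  refine ⟨(M 0 0 * T 0 0 + M 0 1 * T 1 0) * coeffwise D (T 1 1)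
    + coeffwise D (T 0 0) * (M 1 0 * T 0 1 + M 1 1 * T 1 1)
    - X ^ s * coeffwise D (T 0 0) * coeffwise D (T 1 1)
    - (M 0 0 * T 0 1 + M 0 1 * T 1 1) * coeffwise D (T 1 0)
    - coeffwise D (T 0 1) * (M 1 0 * T 0 0 + M 1 1 * T 1 0)
    + X ^ s * coeffwise D (T 0 1) * coeffwise D (T 1 0), ?_⟩
  linear_combination (M 1 0 * T 0 1 + M 1 1 * T 1 1 - X ^ s * coeffwise D (T 1 1)) * e 0 0
    + (T 0 0 * L 0 0 + T 0 1 * L 1 0) * e 1 1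
    - (M 1 0 * T 0 0 + M 1 1 * T 1 0 - X ^ s * coeffwise D (T 1 0)) * e 0 1
    - (T 0 0 * L 0 1 + T 0 1 * L 1 1) * e 1 0

/-- The curvature `P_t - Q_x + [P, Q]` of the Lax pair `(X⁻¹ P, X⁻³ Q)`, with denominators
cleared. -/
noncomputable def curvature (Dx Dt : Derivation ℂ K K) (P Q : Matrix (Fin 2) (Fin 2) K[X])
    (i j : Fin 2) : K[X] :=
  X ^ 3 * coeffwise Dt (P i j) - X * coeffwise Dx (Q i j)
    + (P i 0 * Q 0 j + P i 1 * Q 1 j - (Q i 0 * P 0 j + Q i 1 * P 1 j))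

/-- Gauge transformations preserve zero curvature: `Z' T = T Z` for the two curvatures, since the
mixed derivatives of `T` agree, and `det T` can be cancelled. -/
lemma IsDarbouxPolynomial.curvature_eq_zero (hN : 0 < N) {Dx Dt : Derivation ℂ K K}
    (hD : ∀ y, Dx (Dt y) = Dt (Dx y))
    {P Q P' Q' : Matrix (Fin 2) (Fin 2) K[X]} (hun : IsUnisolvent N m u v)
    (h : IsDarbouxPolynomial N m u v a b c d)
    (hx : IsGauge Dx 1 (darbouxPoly N a b c d) P P')
    (ht : IsGauge Dt 3 (darbouxPoly N a b c d) Q Q')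
    (hZ : ∀ i j, curvature Dx Dt P Q i j = 0) (i j : Fin 2) :
    curvature Dx Dt P' Q' i j = 0 := by
  have key : ∀ i j, curvature Dx Dt P' Q' i 0 * darbouxPoly N a b c d 0 j
      + curvature Dx Dt P' Q' i 1 * darbouxPoly N a b c d 1 j = 0 := by
    intro i j
    generalize darbouxPoly N a b c d = T at *
    have e1 := congrArg (coeffwise Dt) (hx i j)
    have e2 := congrArg (coeffwise Dx) (ht i j)
    have z0 := hZ 0 j
    have z1 := hZ 1 j
    simp only [map_add, coeffwise_mul, coeffwise_X_pow, mul_zero, add_zero] at e1 e2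
    rw [coeffwise_comm Dx Dt hD] at e2
    simp only [curvature] at z0 z1 ⊢
    linear_combination -X ^ 3 * e1 + X * e2 + P 0 j * ht i 0 + P 1 j * ht i 1
      - P' i 0 * ht 0 j - P' i 1 * ht 1 j - Q 0 j * hx i 0 - Q 1 j * hx i 1
      + Q' i 0 * hx 0 j + Q' i 1 * hx 1 j + T i 0 * z0 + T i 1 * z1
  have d0 : curvature Dx Dt P' Q' i 0 = 0 := by
    refine h.eq_zero_of_mul_det hN hun ?_
    rw [Matrix.det_fin_two]
    linear_combination darbouxPoly N a b c d 1 1 * key i 0 - darbouxPoly N a b c d 1 0 * key i 1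
  have d1 : curvature Dx Dt P' Q' i 1 = 0 := by
    refine h.eq_zero_of_mul_det hN hun ?_
    rw [Matrix.det_fin_two]
    linear_combination darbouxPoly N a b c d 0 0 * key i 1 - darbouxPoly N a b c d 0 1 * key i 0
  fin_cases j
  · exact d0
  · exact d1

end Gauge

/-! ### The Lax pair over a differential ring -/

section LaxPair

variable {K : Type*} [CommRing K] [Algebra ℂ K]

/-- Elements `i`, `ρ`, `h` of a differential ring that behave like the constants `i`, `ρ`,
`1 / 2`. -/
structure IsConstants (Dx Dt : Derivation ℂ K K) (i ρ h : K) : Prop where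
  sq : i ^ 2 = -1
  two_mul : 2 * h = 1
  dx_i : Dx i = 0
  dx_ρ : Dx ρ = 0
  dx_h : Dx h = 0
  dt_i : Dt i = 0
  dt_ρ : Dt ρ = 0

/-- The left-hand side of the first equation of the coupled system, in a differential ring. -/
def coupledQ (Dx Dt : Derivation ℂ K K) (i ρ h q r : K) : K :=
  i * Dt q + i * Dx (Dx (Dx q)) + (3 * q * r + 2 * ρ) * Dx (Dx q) + 3 * r * Dx q ^ 2
    + h * (-9 * i * q ^ 2 * r ^ 2 - 20 * i * ρ * q * r + 8 * i * ρ ^ 2 + 6 * q * Dx r) * Dx q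
    + i * (-3 * q ^ 3 * r - 2 * ρ * q ^ 2) * Dx r - 3 * ρ * r ^ 2 * q ^ 3
    - 4 * ρ ^ 2 * r * q ^ 2 + 8 * (ρ ^ 3 - ρ ^ 2) * q

/-- The left-hand side of the second equation of the coupled system, in a differential ring. -/
def coupledR (Dx Dt : Derivation ℂ K K) (i ρ h q r : K) : K :=
  i * Dt r + i * Dx (Dx (Dx r)) - (3 * q * r + 2 * ρ) * Dx (Dx r) - 3 * q * Dx r ^ 2
    + h * (-9 * i * q ^ 2 * r ^ 2 - 20 * i * ρ * q * r + 8 * i * ρ ^ 2 - 6 * r * Dx q) * Dx r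
    + i * (-3 * r ^ 3 * q - 2 * ρ * r ^ 2) * Dx q + 3 * ρ * r ^ 3 * q ^ 2
    + 4 * ρ ^ 2 * r ^ 2 * q + 8 * (-ρ ^ 3 + ρ ^ 2) * r

/-- The spatial Lax matrix, conjugated by `diag(1, l)` and multiplied by `X = l²`. -/
noncomputable def polyP (i ρ q r : K) : Matrix (Fin 2) (Fin 2) K[X] :=
  !![C (-i) + C (i * ρ) * X, C q; C r * X, C i - C (i * ρ) * X]

/-- The temporal Lax matrix, conjugated by `diag(1, l)` and multiplied by `X³ = l⁶`. -/
noncomputable def polyQ (D : Derivation ℂ K K) (i ρ h q r : K) : Matrix (Fin 2) (Fin 2) K[X] :=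
  !![C (-4 * i) + C (-2 * i * q * r + 8 * i * ρ) * X
        + C (-3 * h * i * q ^ 2 * r ^ 2 - D r * q + D q * r) * X ^ 2 + C (-4 * i * ρ ^ 2) * X ^ 3,
      C (4 * q) + C (2 * i * D q + 2 * q ^ 2 * r - 4 * ρ * q) * X
        + C (-D (D q) + 3 * i * D q * q * r + 3 * h * q ^ 3 * r ^ 2 + 2 * ρ * q ^ 2 * r
          - 4 * ρ ^ 2 * q) * X ^ 2;
     C (4 * r) * X + C (-2 * i * D r + 2 * q * r ^ 2 - 4 * ρ * r) * X ^ 2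
        + C (-D (D r) - 3 * i * D r * q * r + 3 * h * q ^ 2 * r ^ 3 + 2 * ρ * q * r ^ 2
          - 4 * ρ ^ 2 * r) * X ^ 3,
      -(C (-4 * i) + C (-2 * i * q * r + 8 * i * ρ) * X
        + C (-3 * h * i * q ^ 2 * r ^ 2 - D r * q + D q * r) * X ^ 2
        + C (-4 * i * ρ ^ 2) * X ^ 3)]

variable {Dx Dt : Derivation ℂ K K} {i ρ h q r : K}

/-- The Lax pair of a solution of the coupled system has zero curvature. -/
lemma curvature_polyP_polyQ (hc : IsConstants Dx Dt i ρ h) (hq : coupledQ Dx Dt i ρ h q r = 0)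
    (hr : coupledR Dx Dt i ρ h q r = 0) (j k : Fin 2) :
    curvature Dx Dt (polyP i ρ q r) (polyQ Dx i ρ h q r) j k = 0 := by
  have s2 : (C i : K[X]) ^ 2 = -1 := by rw [← C_pow, hc.sq]; simp
  have s2h : 2 * (C h : K[X]) = 1 := by
    have := congrArg C hc.two_mul; simpa only [map_mul, map_one, map_ofNat] using this
  have cq := congrArg C hq
  have cr := congrArg C hr
  simp only [coupledQ, coupledR, map_add, map_sub, map_mul, map_neg, map_pow, map_zero, map_ofNat]
    at cq cr
  have f (n : ℕ) [n.AtLeastTwo] : coeffwise Dx (OfNat.ofNat n : K[X]) = 0 :=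
    (coeffwise Dx).map_natCast n
  fin_cases j <;> fin_cases k
  all_goals
    simp only [Fin.zero_eta, Fin.mk_one, Fin.isValue, curvature, polyP, polyQ, Matrix.of_apply,
      Matrix.cons_val', Matrix.cons_val_zero, Matrix.cons_val_one, Matrix.cons_val_fin_one,
      map_add, map_sub, map_neg, map_mul, map_pow, map_ofNat, coeffwise_C,
      coeffwise_X, Derivation.leibniz, Derivation.leibniz_pow, hc.dx_i, hc.dx_ρ,
      hc.dx_h, hc.dt_i, hc.dt_ρ, f, smul_eq_mul, mul_zero, map_zero,
      add_zero, zero_add, sub_zero, neg_zero, nsmul_eq_mul, Nat.cast_ofNat]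
  · grind
  · linear_combination -C i * X ^ 3 * cq
      + (X ^ 3 * (C (Dt q) + C (Dx (Dx (Dx q))) - 9 * C h * C q ^ 2 * C r ^ 2 * C (Dx q)
          - 3 * C q ^ 3 * C r * C (Dx r) - 4 * C ρ * C q * C r * C (Dx q)
          - 2 * C ρ * C q ^ 2 * C (Dx r) + 4 * C ρ ^ 2 * C (Dx q))
        + X ^ 2 * (4 * C ρ - 6 * C q * C r) * C (Dx q) - 4 * X * C (Dx q)) * s2
      + X ^ 3 * (3 * C i * C q * C (Dx q) * C (Dx r) - 3 * C q ^ 3 * C r * C (Dx r)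
          - 10 * C i ^ 2 * C ρ * C q * C r * C (Dx q) + 4 * C i ^ 2 * C ρ ^ 2 * C (Dx q)
          + 3 * C i * C ρ * C q ^ 3 * C r ^ 2) * s2h
  · linear_combination -C i * X ^ 4 * cr
      + X * (X ^ 3 * (C (Dt r) + C (Dx (Dx (Dx r))) - 9 * C h * C r ^ 2 * C q ^ 2 * C (Dx r)
          - 3 * C r ^ 3 * C q * C (Dx q) - 4 * C ρ * C r * C q * C (Dx r)
          - 2 * C ρ * C r ^ 2 * C (Dx q) + 4 * C ρ ^ 2 * C (Dx r))
        + X ^ 2 * (4 * C ρ - 6 * C r * C q) * C (Dx r) - 4 * X * C (Dx r)) * s2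
      + X ^ 4 * (-3 * C i * C r * C (Dx r) * C (Dx q) - 3 * C r ^ 3 * C q * C (Dx q)
          - 10 * C i ^ 2 * C ρ * C r * C q * C (Dx r) + 4 * C i ^ 2 * C ρ ^ 2 * C (Dx r)
          - 3 * C i * C ρ * C r ^ 3 * C q ^ 2) * s2h
  · grind

lemma coeff_mul_two {K : Type*} [CommRing K] (p r : K[X]) : (p * r).coeff 2
    = p.coeff 0 * r.coeff 2 + p.coeff 1 * r.coeff 1 + p.coeff 2 * r.coeff 0 := by
  rw [coeff_mul]
  simp [Finset.Nat.antidiagonal_succ, add_assoc]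

/-- Up to order three at `X = 0` the determinant of the temporal Lax matrix is independent of the
potentials. -/
lemma X_pow_dvd_det_polyQ (hc : IsConstants Dx Dt i ρ h) :
    X ^ 3 ∣ (polyQ Dx i ρ h q r).det - (C 4 - C (8 * ρ) * X) ^ 2 := by
  have s2 := hc.sq
  have s2h := hc.two_mul
  rw [X_pow_dvd_iff]
  intro n hn
  rw [Matrix.det_fin_two, sq]
  have c0 : ∀ x : K, (C x).coeff 1 = 0 := fun x => coeff_C_succ
  have c2 : ∀ x : K, (C x).coeff 2 = 0 := fun x => coeff_C_succ
  interval_cases n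
  · simp only [coeff_sub, mul_coeff_zero, polyQ, Matrix.of_apply,
      Matrix.cons_val', Matrix.cons_val_zero, Matrix.cons_val_one, Matrix.cons_val_fin_one,
      coeff_add, coeff_neg, coeff_C_zero, coeff_X_zero, coeff_X_pow]
    norm_num
    linear_combination (-16) * s2
  · simp only [coeff_sub, mul_coeff_one, mul_coeff_zero, polyQ, Matrix.of_apply,
      Matrix.cons_val', Matrix.cons_val_zero, Matrix.cons_val_one, Matrix.cons_val_fin_one,
      coeff_add, coeff_neg, coeff_C_zero, coeff_X_zero, coeff_X_one, coeff_X_pow, c0]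
    norm_num
    linear_combination (16 * q * r - 64 * ρ) * (-s2)
  · simp only [coeff_sub, coeff_mul_two, mul_coeff_one, mul_coeff_zero, polyQ, Matrix.of_apply,
      Matrix.cons_val', Matrix.cons_val_zero, Matrix.cons_val_one, Matrix.cons_val_fin_one,
      coeff_add, coeff_neg, coeff_C_zero, coeff_X_pow, c0, c2, coeff_X]
    norm_num
    grind

/-- The temporal Lax matrix is determined by zero curvature together with its trace, its
determinant up to order three, and its lowest and highest coefficients; the remaining coefficient
equations are the coupled system. -/
lemma eq_polyQ_of_curvature_eq_zero (hc : IsConstants Dx Dt i ρ h)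
    {M : Matrix (Fin 2) (Fin 2) K[X]} (hM : ∀ j k, M j k ∈ degreeLT K 4)
    (htr : M 0 0 + M 1 1 = 0) (h000 : (M 0 0).coeff 0 = -4 * i) (h100 : (M 1 0).coeff 0 = 0)
    (h003 : (M 0 0).coeff 3 = -4 * i * ρ ^ 2) (h013 : (M 0 1).coeff 3 = 0)
    (hdet : X ^ 3 ∣ M.det - (C 4 - C (8 * ρ) * X) ^ 2)
    (hZ : ∀ j k, curvature Dx Dt (polyP i ρ q r) M j k = 0) :
    M = polyQ Dx i ρ h q r ∧ coupledQ Dx Dt i ρ h q r = 0 ∧ coupledR Dx Dt i ρ h q r = 0 := by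
  have s2 := hc.sq
  have s2h := hc.two_mul
  have h11 : M 1 1 = -M 0 0 := by linear_combination htr
  have z01 := hZ 0 1
  have z10 := hZ 1 0
  have d1 := X_pow_dvd_iff.mp hdet 1 (by norm_num)
  have d2 := X_pow_dvd_iff.mp hdet 2 (by norm_num)
  simp only [curvature, polyP, Matrix.of_apply, Matrix.cons_val', Matrix.cons_val_zero,
    Matrix.cons_val_one, Matrix.cons_val_fin_one, coeffwise_C, coeffwise_mul, coeffwise_X, h11]
    at z01 z10
  rw [Matrix.det_fin_two, h11, sq] at d1 d2
  have y01 : C (Dt q) * X ^ 3 - coeffwise Dx (M 0 1) * X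
      + (C (2 * i * ρ) * (M 0 1 * X) - C (2 * i) * M 0 1 - C (2 * q) * M 0 0) = 0 := by
    simp only [map_mul, map_ofNat, map_neg] at z01 ⊢
    linear_combination z01
  have y10 : C (Dt r) * X ^ 4 - coeffwise Dx (M 1 0) * X
      + (C (2 * r) * (M 0 0 * X) + C (2 * i) * M 1 0 - C (2 * i * ρ) * (M 1 0 * X)) = 0 := by
    simp only [map_mul, map_ofNat, map_neg] at z10 ⊢
    linear_combination z10
  have y01c := fun n => congrArg (fun f => coeff f n) y01
  have y10c := fun n => congrArg (fun f => coeff f n) y10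
  clear y01 y10 z01 z10
  have e0 := y01c 0
  have e1 := y01c 1
  have e2 := y01c 2
  have e3 := y01c 3
  have f1 := y10c 1
  have f2 := y10c 2
  have f3 := y10c 3
  have f4 := y10c 4
  have c1 : ∀ x : K, (C x).coeff 1 = 0 := fun x => coeff_C_succ
  have c2 : ∀ x : K, (C x).coeff 2 = 0 := fun x => coeff_C_succ
  have m104 := mem_degreeLT_iff_coeff.mp (hM 1 0) 4 le_rfl
  have hnum (n : ℕ) [n.AtLeastTwo] : Dx (OfNat.ofNat n : K) = 0 := Dx.map_natCast n
  have can2 : ∀ x : K, 2 * i * x = 0 → x = 0 := fun x hx => by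
    linear_combination (-i * h) * hx + x * 2 * h * s2 - x * s2h
  have can8 : ∀ x : K, 8 * i * x = 0 → x = 0 := fun x hx => can2 x (by
    linear_combination h ^ 2 * hx - 2 * i * x * (1 + 2 * h) * s2h)
  simp only [coeff_add, coeff_sub, coeff_C_mul, coeff_mul_X, coeff_mul_X_zero, coeff_X_pow,
    coeff_coeffwise, coeff_zero, h000, h100, h013, h003, m104, OfNat.one_ne_ofNat,
    OfNat.zero_ne_ofNat, if_false, if_true, mul_zero, mul_one, sub_zero, zero_sub, zero_add,
    Nat.reduceEqDiff, map_zero] at e0 e1 e2 e3 f1 f2 f3 f4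
  simp only [coeff_sub, coeff_neg, coeff_mul_two, mul_coeff_one, mul_coeff_zero,
    coeff_C_zero, c1, c2, coeff_X_zero, coeff_X_one, h000, h100, mul_zero, mul_one,
    coeff_X_of_ne_one (show 2 ≠ 1 by norm_num)] at d1 d2
  have y0 : (M 0 1).coeff 0 = 4 * q := by
    refine sub_eq_zero.mp (can2 _ ?_)
    linear_combination -e0
  have z1 : (M 1 0).coeff 1 = 4 * r := by
    refine sub_eq_zero.mp (can2 _ ?_)
    linear_combination f1
  have x1 : (M 0 0).coeff 1 = -2 * i * q * r + 8 * i * ρ := by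
    refine sub_eq_zero.mp (can8 _ ?_)
    linear_combination d1 + (16 * q * r - 64 * ρ) * s2 + (M 1 0).coeff 1 * y0 + 4 * q * z1
  rw [y0, x1, Derivation.leibniz, hnum] at e1
  simp only [smul_eq_mul, mul_zero, add_zero] at e1
  have y1 : (M 0 1).coeff 1 = 2 * i * Dx q + 2 * q ^ 2 * r - 4 * ρ * q := by
    refine sub_eq_zero.mp (can2 _ ?_)
    linear_combination -e1 - 4 * Dx q * s2
  rw [z1, x1, Derivation.leibniz, hnum] at f2
  simp only [smul_eq_mul, mul_zero, add_zero] at f2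
  have z2 : (M 1 0).coeff 2 = -2 * i * Dx r + 2 * q * r ^ 2 - 4 * ρ * r := by
    refine sub_eq_zero.mp (can2 _ ?_)
    linear_combination f2 + 4 * Dx r * s2
  rw [x1, y0, z2, y1, z1] at d2
  have x2 : (M 0 0).coeff 2 = -3 * h * i * q ^ 2 * r ^ 2 - Dx r * q + Dx q * r := by
    refine sub_eq_zero.mp (can8 _ ?_)
    linear_combination d2 + (16 * q ^ 2 * r ^ 2 - 32 * q * r * ρ + 64 * ρ ^ 2) * s2
      + 12 * i ^ 2 * q ^ 2 * r ^ 2 * s2h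
  rw [y1, x2] at e2
  simp only [map_add, map_sub, Derivation.leibniz, Derivation.leibniz_pow, hc.dx_i,
    hc.dx_ρ, hnum, smul_eq_mul, nsmul_eq_mul, Nat.cast_ofNat, mul_zero, add_zero] at e2
  have y2 : (M 0 1).coeff 2 = -Dx (Dx q) + 3 * i * Dx q * q * r + 3 * h * q ^ 3 * r ^ 2
      + 2 * ρ * q ^ 2 * r - 4 * ρ ^ 2 * q := by
    refine sub_eq_zero.mp (can2 _ ?_)
    linear_combination -e2 + (4 * ρ - 6 * q * r) * Dx q * s2
  rw [z2, x2] at f3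
  simp only [map_add, map_sub, map_neg, Derivation.leibniz, Derivation.leibniz_pow, hc.dx_i,
    hc.dx_ρ, hnum, smul_eq_mul, nsmul_eq_mul, Nat.cast_ofNat, mul_zero, add_zero, neg_zero] at f3
  have z3 : (M 1 0).coeff 3 = -Dx (Dx r) - 3 * i * Dx r * q * r + 3 * h * q ^ 2 * r ^ 3
      + 2 * ρ * q * r ^ 2 - 4 * ρ ^ 2 * r := by
    refine sub_eq_zero.mp (can2 _ ?_)
    linear_combination f3 - (4 * ρ - 6 * q * r) * Dx r * s2
  rw [y2] at e3
  rw [z3] at f4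
  simp only [map_add, map_sub, map_neg, Derivation.leibniz, Derivation.leibniz_pow, hc.dx_i,
    hc.dx_ρ, hc.dx_h, hnum, smul_eq_mul, nsmul_eq_mul, Nat.cast_ofNat, mul_zero, add_zero]
    at e3 f4
  refine ⟨?_, can2 _ ?_, can2 _ ?_⟩
  · have hpoly : ∀ p : K[X], p ∈ degreeLT K 4 → p = C (p.coeff 0) + C (p.coeff 1) * X
        + C (p.coeff 2) * X ^ 2 + C (p.coeff 3) * X ^ 3 := by
      intro p hp
      have := as_sum_range' p 4 (by
        have := mem_degreeLT_succ_iff_natDegree_le.mp hp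
        omega)
      simpa [Finset.sum_range_succ, ← C_mul_X_pow_eq_monomial] using this
    ext1 j k
    fin_cases j <;> fin_cases k
    · exact (hpoly _ (hM 0 0)).trans (by rw [h000, x1, x2, h003]; rfl)
    · exact (hpoly _ (hM 0 1)).trans (by rw [y0, y1, y2, h013, C_0, zero_mul, add_zero]; rfl)
    · exact (hpoly _ (hM 1 0)).trans (by rw [h100, z1, z2, z3, C_0, zero_add]; rfl)
    · refine h11.trans ((congrArg (- ·) (hpoly _ (hM 0 0))).trans ?_)
      beta_reduce
      rw [h000, x1, x2, h003]; rfl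
  · simp only [coupledQ]
    linear_combination -2 * e3
      + 2 * (Dt q + Dx (Dx (Dx q)) - 9 * h * q ^ 2 * r ^ 2 * Dx q - 3 * q ^ 3 * r * Dx r
        - 4 * ρ * q * r * Dx q - 2 * ρ * q ^ 2 * Dx r + 4 * ρ ^ 2 * Dx q) * s2
      + 2 * (3 * i * q * Dx q * Dx r - 3 * q ^ 3 * r * Dx r - 10 * i ^ 2 * ρ * q * r * Dx q
        + 4 * i ^ 2 * ρ ^ 2 * Dx q + 3 * i * ρ * q ^ 3 * r ^ 2) * s2h
  · simp only [coupledR]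
    linear_combination -2 * f4
      + 2 * (Dt r + Dx (Dx (Dx r)) - 9 * h * r ^ 2 * q ^ 2 * Dx r - 3 * r ^ 3 * q * Dx q
        - 4 * ρ * r * q * Dx r - 2 * ρ * r ^ 2 * Dx q + 4 * ρ ^ 2 * Dx r) * s2
      + 2 * (-3 * i * r * Dx r * Dx q - 3 * r ^ 3 * q * Dx q - 10 * i ^ 2 * ρ * r * q * Dx r
        + 4 * i ^ 2 * ρ ^ 2 * Dx r - 3 * i * ρ * r ^ 3 * q ^ 2) * s2h

end LaxPair

/-! ### The Darboux transformation over a differential ring -/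

section DarbouxTransformation

variable {K : Type*} [CommRing K] [Algebra ℂ K] {ι : Type*}
variable {N : ℕ} {m u v : ι → K} {a b c d : K[X]}
variable {Dx Dt : Derivation ℂ K K} {i ρ h q r : K}

lemma polyP_mem_degreeLT {K : Type*} [CommRing K] {i ρ q r : K} (j k : Fin 2) :
    polyP i ρ q r j k ∈ degreeLT K 2 := by
  rw [mem_degreeLT_succ_iff_natDegree_le]
  fin_cases j <;> fin_cases k <;> simp only [polyP, Fin.zero_eta, Fin.mk_one, Matrix.of_apply,
    Matrix.cons_val', Matrix.cons_val_zero, Matrix.cons_val_one, Matrix.cons_val_fin_one] <;>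
    compute_degree!

lemma polyQ_mem_degreeLT (j k : Fin 2) : polyQ Dx i ρ h q r j k ∈ degreeLT K 4 := by
  rw [mem_degreeLT_succ_iff_natDegree_le]
  fin_cases j <;> fin_cases k <;> simp only [polyQ, Fin.zero_eta, Fin.mk_one, Matrix.of_apply,
    Matrix.cons_val', Matrix.cons_val_zero, Matrix.cons_val_one, Matrix.cons_val_fin_one] <;>
    compute_degree!

/-- The spatial part of the Darboux transformation: the diagonal of the transformed matrix is
unchanged by `extreme_coeff`, and its off-diagonal entries are read off from the leading
coefficients of the gauge relation. -/
lemma IsDarbouxPolynomial.isGauge_polyP (hN : 0 < N) (hun : IsUnisolvent N m u v)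
    (hT : IsDarbouxPolynomial N m u v a b c d) (hm : ∀ k, Dx (m k) = 0)
    (hu : ∀ k, m k * Dx (u k) = (-i + i * ρ * m k) * u k + q * v k)
    (hv : ∀ k, m k * Dx (v k) = r * m k * u k + (i - i * ρ * m k) * v k) :
    IsGauge Dx 1 (darbouxPoly N a b c d) (polyP i ρ q r)
      (polyP i ρ (q - 2 * i * ρ * b.coeff (N - 1) + Dx (b.coeff (N - 1)))
        (r + 2 * i * ρ * c.coeff (N - 1) + Dx (c.coeff (N - 1)))) := by
  obtain ⟨M, hM, hg⟩ := hT.exists_isGauge (D := Dx) (s := 1) (L := polyP i ρ q r) hun hm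
    (fun k => by simpa [polyP] using hu k) (fun k => by simpa [polyP] using hv k)
    polyP_mem_degreeLT
  have c1 : ∀ x : K, (C x).coeff 1 = 0 := fun x => coeff_C_succ
  have l000 : (polyP i ρ q r 0 0).coeff 0 = -i := by simp [polyP]
  have l110 : (polyP i ρ q r 1 1).coeff 0 = i := by simp [polyP]
  have l001 : (polyP i ρ q r 0 0).coeff 1 = i * ρ := by simp [polyP, c1, -map_mul]
  have l111 : (polyP i ρ q r 1 1).coeff 1 = -(i * ρ) := by simp [polyP, c1, -map_mul]
  obtain ⟨e1, e2, e3, e4, e5, e6⟩ := hT.extreme_coeff hN one_pos hun polyP_mem_degreeLT hM hg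
    (by simp [polyP]) (c1 q)
  have hlin : ∀ p : K[X], p ∈ degreeLT K 2 → p = C (p.coeff 0) + C (p.coeff 1) * X := by
    intro p hp
    have := as_sum_range' p 2 (by
      have := mem_degreeLT_succ_iff_natDegree_le.mp hp
      omega)
    simpa [Finset.sum_range_succ, ← C_mul_X_pow_eq_monomial] using this
  have hMP : M = polyP i ρ ((M 0 1).coeff 0) ((M 1 0).coeff 1) := by
    ext1 j k
    fin_cases j <;> fin_cases k
    · exact (hlin _ (hM 0 0)).trans (by rw [e1, e4, l000, l001]; rfl)
    · exact (hlin _ (hM 0 1)).trans (by rw [e5, C_0, zero_mul, add_zero]; rfl)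
    · exact (hlin _ (hM 1 0)).trans (by rw [e2, C_0, zero_add]; rfl)
    · exact (hlin _ (hM 1 1)).trans
        (by rw [e3, e6, l110, l111, C_neg, neg_mul, ← sub_eq_add_neg]; rfl)
  generalize (M 0 1).coeff 0 = q' at hMP
  generalize (M 1 0).coeff 1 = r' at hMP
  subst hMP
  obtain ⟨n, rfl⟩ : ∃ n, N = n + 1 := ⟨N - 1, by omega⟩
  have hb := mem_degreeLT_iff_coeff.mp hT.deg_b (n + 1) le_rfl
  have hc := mem_degreeLT_iff_coeff.mp hT.deg_c (n + 1) le_rfl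
  have ha1 := coeff_X_pow_add hT.deg_a
  have hd1 := coeff_X_pow_add hT.deg_d
  have g01 := hg 0 1
  have g10 := hg 1 0
  simp only [polyP, darbouxPoly, Matrix.of_apply, Matrix.cons_val', Matrix.cons_val_zero,
    Matrix.cons_val_one, Matrix.cons_val_fin_one, pow_one, coeffwise_mul, coeffwise_X] at g01 g10
  have y01 : X * coeffwise Dx b + C q * (X ^ (n + 1) + a) + C (2 * i) * b
      - C (2 * i * ρ) * (X * b) = C q' * (X ^ (n + 1) + d) := by
    simp only [map_mul, map_ofNat, map_neg] at g01 ⊢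
    linear_combination g01
  have y10 : X * (X * coeffwise Dx c) + C r * (X * (X ^ (n + 1) + d)) - C (2 * i) * (X * c)
      + C (2 * i * ρ) * (X * (X * c)) = C r' * (X * (X ^ (n + 1) + a)) := by
    simp only [map_mul, map_ofNat, map_neg] at g10 ⊢
    linear_combination g10
  replace y01 := congrArg (fun f => coeff f (n + 1)) y01
  replace y10 := congrArg (fun f => coeff f (n + 1 + 1)) y10
  rw [coeff_add] at ha1 hd1
  simp only [coeff_add, coeff_sub, coeff_C_mul, coeff_X_mul, coeff_coeffwise, hb, hc, ha1, hd1,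
    mul_zero, mul_one] at y01 y10
  have hq : q' = q - 2 * i * ρ * b.coeff n + Dx (b.coeff n) := by linear_combination -y01
  have hr : r' = r + 2 * i * ρ * c.coeff n + Dx (c.coeff n) := by linear_combination -y10
  rw [Nat.add_sub_cancel, ← hq, ← hr]
  exact hg

/-- The Darboux transformation in a differential ring: if the spatial Lax matrices of `(q, r)` and
`(q', r')` are gauge equivalent under the Darboux matrix, so are the temporal ones, and `(q', r')`
solves the coupled system. -/
lemma IsDarbouxPolynomial.isGauge_polyQ (hN : 0 < N) (hun : IsUnisolvent N m u v)
    (hT : IsDarbouxPolynomial N m u v a b c d) (hc : IsConstants Dx Dt i ρ h)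
    (hD : ∀ y, Dx (Dt y) = Dt (Dx y)) (hm : ∀ k, Dt (m k) = 0)
    (hu : ∀ k, m k ^ 3 * Dt (u k) = (polyQ Dx i ρ h q r 0 0).eval (m k) * u k
      + (polyQ Dx i ρ h q r 0 1).eval (m k) * v k)
    (hv : ∀ k, m k ^ 3 * Dt (v k) = (polyQ Dx i ρ h q r 1 0).eval (m k) * u k
      + (polyQ Dx i ρ h q r 1 1).eval (m k) * v k)
    (hq : coupledQ Dx Dt i ρ h q r = 0) (hr : coupledR Dx Dt i ρ h q r = 0) {q' r' : K}
    (hg : IsGauge Dx 1 (darbouxPoly N a b c d) (polyP i ρ q r) (polyP i ρ q' r')) :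
    IsGauge Dt 3 (darbouxPoly N a b c d) (polyQ Dx i ρ h q r) (polyQ Dx i ρ h q' r') ∧
      coupledQ Dx Dt i ρ h q' r' = 0 ∧ coupledR Dx Dt i ρ h q' r' = 0 := by
  obtain ⟨M, hM, hgM⟩ := hT.exists_isGauge (D := Dt) (s := 3) (L := polyQ Dx i ρ h q r) hun hm
    hu hv polyQ_mem_degreeLT
  have c3 : ∀ x : K, (C x).coeff 3 = 0 := fun x => coeff_C_succ
  have l100 : (polyQ Dx i ρ h q r 1 0).coeff 0 = 0 := by simp [polyQ]
  have l013 : (polyQ Dx i ρ h q r 0 1).coeff 3 = 0 := by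
    simp only [polyQ, Matrix.of_apply, Matrix.cons_val', Matrix.cons_val_zero,
      Matrix.cons_val_one, Matrix.cons_val_fin_one, coeff_add, c3, coeff_C_mul, coeff_X_pow,
      coeff_X]
    norm_num
  have l000 : (polyQ Dx i ρ h q r 0 0).coeff 0 = -4 * i := by simp [polyQ]
  have l003 : (polyQ Dx i ρ h q r 0 0).coeff 3 = -4 * i * ρ ^ 2 := by
    simp only [polyQ, Matrix.of_apply, Matrix.cons_val', Matrix.cons_val_zero,
      Matrix.cons_val_fin_one, coeff_add, c3, coeff_C_mul, coeff_X_pow, coeff_X]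
    norm_num
  obtain ⟨e1, e2, -, e4, e5, -⟩ := hT.extreme_coeff hN (by norm_num) hun polyQ_mem_degreeLT hM
    hgM l100 l013
  have htr := hT.trace_eq_zero hN (by norm_num) hun polyQ_mem_degreeLT hM hgM l100 l013
    (by simp [polyQ])
  have hdet : X ^ 3 ∣ M.det - (C 4 - C (8 * ρ) * X) ^ 2 := by
    have := dvd_add (hT.X_pow_dvd_det_sub hN hun hgM) (X_pow_dvd_det_polyQ (q := q) (r := r) hc)
    rwa [sub_add_sub_cancel] at this
  obtain ⟨hMQ, hq', hr'⟩ := eq_polyQ_of_curvature_eq_zero (q := q') (r := r') hc hM htr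
    (e1.trans l000) e2 (e4.trans l003) e5 hdet
    (hT.curvature_eq_zero hN hD hun hg hgM (curvature_polyP_polyQ hc hq hr))
  exact ⟨hMQ ▸ hgM, hq', hr'⟩

end DarbouxTransformation

/-! ### Determinant formulas -/

section Interpolation

variable {K : Type*} [CommRing K] {N : ℕ}

/-- The matrix `B12` over an arbitrary ring. -/
def ringB12 (N : ℕ) (l φ₁ φ₂ : Fin (2 * N) → K) : Matrix (Fin (2 * N)) (Fin (2 * N)) K :=
  Matrix.of fun k c =>
    if (c : ℕ) % 2 = 0 then l k ^ (2 * N - 2 - (c : ℕ)) * φ₁ k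
    else l k ^ (2 * N - (c : ℕ)) * φ₂ k

/-- The matrix `B22` over an arbitrary ring. -/
def ringB22 (N : ℕ) (l φ₁ φ₂ : Fin (2 * N) → K) : Matrix (Fin (2 * N)) (Fin (2 * N)) K :=
  Matrix.of fun k c =>
    l k ^ (2 * N - 1 - (c : ℕ)) * (if (c : ℕ) % 2 = 0 then φ₁ k else φ₂ k)

/-- The coefficients of a pair of polynomials of degree less than `N`, arranged in the column order
of `B12` and `B22`: highest degree first, alternating between the two polynomials. -/
def interleave (N : ℕ) (a b : K[X]) (c : Fin (2 * N)) : K :=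
  if (c : ℕ) % 2 = 0 then a.coeff (N - 1 - c / 2) else b.coeff (N - 1 - c / 2)

lemma sum_fin_two_mul (F : ℕ → K) :
    ∑ c : Fin (2 * N), F c
      = ∑ j ∈ Finset.range N, (F (2 * (N - 1 - j)) + F (2 * (N - 1 - j) + 1)) := by
  have h : ∀ n, ∑ c ∈ Finset.range (2 * n), F c
      = ∑ j ∈ Finset.range n, (F (2 * j) + F (2 * j + 1)) := by
    intro n
    induction n with
    | zero => simp
    | succ n ih =>
      rw [Finset.sum_range_succ, ← ih, Nat.mul_succ, Finset.sum_range_succ, Finset.sum_range_succ,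
        add_assoc]
  rw [Fin.sum_univ_eq_sum_range, h,
    ← Finset.sum_range_reflect (fun j => F (2 * j) + F (2 * j + 1)) N]

lemma eval_eq_sum_range_of_mem_degreeLT {p : K[X]} (hp : p ∈ degreeLT K N) (x : K) :
    p.eval x = ∑ j ∈ Finset.range N, p.coeff j * x ^ j := by
  rw [mem_degreeLT_iff_coeff] at hp
  rw [eval_eq_sum, sum_def]
  refine Finset.sum_subset (fun n hn => ?_) (fun n _ hn => ?_)
  · rw [mem_support_iff] at hn
    rw [Finset.mem_range]
    by_contra hN
    exact hn (hp n (by omega))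
  · rw [notMem_support_iff.mp hn, zero_mul]

lemma ringB12_mulVec_interleave (l φ₁ φ₂ : Fin (2 * N) → K) {a b : K[X]}
    (ha : a ∈ degreeLT K N) (hb : b ∈ degreeLT K N) (k : Fin (2 * N)) :
    (ringB12 N l φ₁ φ₂).mulVec (interleave N a b) k
      = a.eval (l k ^ 2) * φ₁ k + b.eval (l k ^ 2) * (l k * φ₂ k) := by
  rw [eval_eq_sum_range_of_mem_degreeLT ha, eval_eq_sum_range_of_mem_degreeLT hb,
    Finset.sum_mul, Finset.sum_mul, ← Finset.sum_add_distrib]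
  refine (sum_fin_two_mul fun c => (if c % 2 = 0 then l k ^ (2 * N - 2 - c) * φ₁ k
    else l k ^ (2 * N - c) * φ₂ k) *
      (if c % 2 = 0 then a.coeff (N - 1 - c / 2) else b.coeff (N - 1 - c / 2))).trans ?_
  refine Finset.sum_congr rfl fun j hj => ?_
  rw [Finset.mem_range] at hj
  rw [if_pos (by omega), if_pos (by omega), if_neg (by omega), if_neg (by omega),
    show 2 * N - 2 - 2 * (N - 1 - j) = 2 * j by omega,
    show 2 * N - (2 * (N - 1 - j) + 1) = 2 * j + 1 by omega,
    show N - 1 - 2 * (N - 1 - j) / 2 = j by omega,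
    show N - 1 - (2 * (N - 1 - j) + 1) / 2 = j by omega]
  ring

lemma ringB22_mulVec_interleave (l φ₁ φ₂ : Fin (2 * N) → K) {a b : K[X]}
    (ha : a ∈ degreeLT K N) (hb : b ∈ degreeLT K N) (k : Fin (2 * N)) :
    l k * (ringB22 N l φ₁ φ₂).mulVec (interleave N a b) k
      = l k ^ 2 * a.eval (l k ^ 2) * φ₁ k + b.eval (l k ^ 2) * (l k * φ₂ k) := by
  rw [eval_eq_sum_range_of_mem_degreeLT ha, eval_eq_sum_range_of_mem_degreeLT hb,
    Finset.mul_sum, Finset.sum_mul, Finset.sum_mul, ← Finset.sum_add_distrib]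
  refine (congrArg (l k * ·) (sum_fin_two_mul fun c => (l k ^ (2 * N - 1 - c) *
    (if c % 2 = 0 then φ₁ k else φ₂ k)) *
      (if c % 2 = 0 then a.coeff (N - 1 - c / 2) else b.coeff (N - 1 - c / 2)))).trans ?_
  rw [Finset.mul_sum]
  refine Finset.sum_congr rfl fun j hj => ?_
  rw [Finset.mem_range] at hj
  rw [if_pos (by omega), if_pos (by omega), if_neg (by omega), if_neg (by omega),
    show 2 * N - 1 - 2 * (N - 1 - j) = 2 * j + 1 by omega,
    show 2 * N - 1 - (2 * (N - 1 - j) + 1) = 2 * j by omega,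
    show N - 1 - 2 * (N - 1 - j) / 2 = j by omega,
    show N - 1 - (2 * (N - 1 - j) + 1) / 2 = j by omega]
  ring

lemma exists_interleave_eq (w : Fin (2 * N) → K) :
    ∃ a b : K[X], a ∈ degreeLT K N ∧ b ∈ degreeLT K N ∧ interleave N a b = w := by
  have build : ∀ f : ℕ → K, ∃ p ∈ degreeLT K N, ∀ j < N, p.coeff j = f j := by
    intro f
    refine ⟨∑ j ∈ Finset.range N, C (f j) * X ^ j, ?_, ?_⟩
    · rw [mem_degreeLT_iff_coeff]
      intro n hn
      simp only [finsetSum_coeff, coeff_C_mul_X_pow]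
      refine Finset.sum_eq_zero fun j hj => if_neg ?_
      rw [Finset.mem_range] at hj
      omega
    · intro n hn
      simp only [finsetSum_coeff, coeff_C_mul_X_pow]
      rw [Finset.sum_ite_eq, if_pos (Finset.mem_range.mpr hn)]
  obtain ⟨a, ha, ha'⟩ := build fun j =>
    if hj : j < N then w ⟨2 * (N - 1 - j), by omega⟩ else 0
  obtain ⟨b, hb, hb'⟩ := build fun j =>
    if hj : j < N then w ⟨2 * (N - 1 - j) + 1, by omega⟩ else 0
  refine ⟨a, b, ha, hb, funext fun c => ?_⟩
  have hc := c.isLt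
  unfold interleave
  split_ifs with h
  · rw [ha' _ (by omega), dif_pos (by omega)]
    congr 1
    ext
    simp only
    omega
  · rw [hb' _ (by omega), dif_pos (by omega)]
    congr 1
    ext
    simp only
    omega

lemma eq_zero_of_interleave_eq_zero {a b : K[X]} (ha : a ∈ degreeLT K N) (hb : b ∈ degreeLT K N)
    (h : interleave N a b = 0) : a = 0 ∧ b = 0 := by
  rw [mem_degreeLT_iff_coeff] at ha hb
  constructor <;> ext n <;> rw [coeff_zero] <;> rcases lt_or_ge n N with hn | hn
  · have := congrFun h ⟨2 * (N - 1 - n), by omega⟩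
    simp only [interleave, Pi.zero_apply] at this
    rwa [if_pos (by omega), show N - 1 - 2 * (N - 1 - n) / 2 = n by omega] at this
  · exact ha n hn
  · have := congrFun h ⟨2 * (N - 1 - n) + 1, by omega⟩
    simp only [interleave, Pi.zero_apply] at this
    rwa [if_neg (by omega), show N - 1 - (2 * (N - 1 - n) + 1) / 2 = n by omega] at this
  · exact hb n hn

lemma mulVec_eq_zero_of_isUnit_det {n : Type*} [Fintype n] [DecidableEq n] {B : Matrix n n K}
    (hB : IsUnit B.det) {w : n → K} (h : B.mulVec w = 0) : w = 0 := by
  have := congrArg B⁻¹.mulVec h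
  rwa [Matrix.mulVec_mulVec, Matrix.nonsing_inv_mul _ hB, Matrix.one_mulVec,
    Matrix.mulVec_zero] at this

/-- The interpolation problems have unique solutions where `|B12|` and `|B22|` are invertible. -/
lemma isUnisolvent_of_isUnit_det {l φ₁ φ₂ : Fin (2 * N) → K} (hl : ∀ k, IsUnit (l k))
    (h12 : IsUnit (ringB12 N l φ₁ φ₂).det) (h22 : IsUnit (ringB22 N l φ₁ φ₂).det) :
    IsUnisolvent N (fun k => l k ^ 2) φ₁ (fun k => l k * φ₂ k) where
  isUnit_node k := (hl k).pow 2
  inj₁ a b ha hb hab := by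
    refine eq_zero_of_interleave_eq_zero ha hb
      (mulVec_eq_zero_of_isUnit_det h12 (funext fun k => ?_))
    rw [ringB12_mulVec_interleave l φ₁ φ₂ ha hb]
    exact hab k
  surj₁ w := by
    obtain ⟨a, b, ha, hb, hab⟩ := exists_interleave_eq ((ringB12 N l φ₁ φ₂)⁻¹.mulVec w)
    refine ⟨a, b, ha, hb, fun k => ?_⟩
    rw [← ringB12_mulVec_interleave l φ₁ φ₂ ha hb, hab, Matrix.mulVec_mulVec,
      Matrix.mul_nonsing_inv _ h12, Matrix.one_mulVec]
  inj₂ a b ha hb hab := by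
    refine eq_zero_of_interleave_eq_zero ha hb
      (mulVec_eq_zero_of_isUnit_det h22 (funext fun k => ?_))
    refine (hl k).mul_left_cancel ?_
    rw [ringB22_mulVec_interleave l φ₁ φ₂ ha hb, Pi.zero_apply, mul_zero]
    simpa using hab k
  surj₂ w := by
    choose e he using fun k => (hl k).exists_right_inv
    obtain ⟨a, b, ha, hb, hab⟩ :=
      exists_interleave_eq ((ringB22 N l φ₁ φ₂)⁻¹.mulVec fun k => e k * w k)
    refine ⟨a, b, ha, hb, fun k => ?_⟩
    rw [← ringB22_mulVec_interleave l φ₁ φ₂ ha hb, hab, Matrix.mulVec_mulVec,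
      Matrix.mul_nonsing_inv _ h22, Matrix.one_mulVec, ← mul_assoc, he, one_mul]

/-- Cramer's rule for a known solution. -/
lemma mul_det_eq_det_updateCol {n : Type*} [Fintype n] [DecidableEq n] {B : Matrix n n K}
    {w y : n → K} (h : B.mulVec w = y) (j : n) : w j * B.det = (B.updateCol j y).det := by
  rw [← Matrix.cramer_apply, Matrix.cramer_eq_adjugate_mulVec, ← h, Matrix.mulVec_mulVec,
    Matrix.adjugate_mul, Matrix.smul_mulVec, Matrix.one_mulVec, Pi.smul_apply, smul_eq_mul,
    mul_comm]

variable {l φ₁ φ₂ : Fin (2 * N) → K} {a b c d : K[X]}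

lemma IsDarbouxPolynomial.coeff_b_mul_det (hN : 0 < N)
    (h : IsDarbouxPolynomial N (fun k => l k ^ 2) φ₁ (fun k => l k * φ₂ k) a b c d) :
    b.coeff (N - 1) * (ringB12 N l φ₁ φ₂).det = ((ringB12 N l φ₁ φ₂).updateCol
      ⟨1, by omega⟩ fun k => -l k ^ (2 * N) * φ₁ k).det := by
  have hw : interleave N a b ⟨1, by omega⟩ = b.coeff (N - 1) := by simp [interleave]
  rw [← hw]
  refine mul_det_eq_det_updateCol (funext fun k => ?_) (⟨1, by omega⟩ : Fin (2 * N))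
  have := h.row₁ k
  rw [ringB12_mulVec_interleave l φ₁ φ₂ h.deg_a h.deg_b]
  simp only [eval_add, eval_pow, eval_X] at this
  linear_combination this

lemma IsDarbouxPolynomial.coeff_c_mul_det (hN : 0 < N) (hl : ∀ k, IsUnit (l k))
    (h : IsDarbouxPolynomial N (fun k => l k ^ 2) φ₁ (fun k => l k * φ₂ k) a b c d) :
    c.coeff (N - 1) * (ringB22 N l φ₁ φ₂).det = ((ringB22 N l φ₁ φ₂).updateCol
      ⟨0, by omega⟩ fun k => -l k ^ (2 * N) * φ₂ k).det := by
  have hw : interleave N c d ⟨0, by omega⟩ = c.coeff (N - 1) := by simp [interleave]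
  rw [← hw]
  refine mul_det_eq_det_updateCol (funext fun k => ?_) _
  refine (hl k).mul_left_cancel ?_
  have := h.row₂ k
  rw [ringB22_mulVec_interleave l φ₁ φ₂ h.deg_c h.deg_d]
  simp only [eval_add, eval_pow, eval_X, eval_mul] at this
  linear_combination this

end Interpolation

/-! ### The differential ring of smooth functions -/

section SmoothFunctions

variable {U : TopologicalSpace.Opens (ℝ × ℝ)}

/-- Extension by zero of a function on `U`. -/
noncomputable def extendZero (f : U → ℂ) : ℝ × ℝ → ℂ :=
  Function.extend Subtype.val f 0

lemma extendZero_apply (f : U → ℂ) {p : ℝ × ℝ} (hp : p ∈ U) : extendZero f p = f ⟨p, hp⟩ :=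
  Subtype.val_injective.extend_apply f 0 (⟨p, hp⟩ : U)

variable (U) in
/-- The algebra of smooth complex functions on the open set `U`, encoded as functions on the
subtype whose extension by zero is smooth on `U`. -/
def smoothAlgebra : Subalgebra ℂ (U → ℂ) where
  carrier := {f | ContDiffOn ℝ ∞ (extendZero f) U}
  mul_mem' {f g} hf hg := (ContDiffOn.mul hf hg).congr fun p hp => by
    simp only [extendZero_apply _ hp, Pi.mul_apply]
  add_mem' {f g} hf hg := (ContDiffOn.add hf hg).congr fun p hp => by
    simp only [extendZero_apply _ hp, Pi.add_apply]
  algebraMap_mem' c := (contDiffOn_const (c := c)).congr fun p hp => extendZero_apply _ hp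

lemma contDiffOn_extendZero (a : smoothAlgebra U) : ContDiffOn ℝ ∞ (extendZero a.1) U := a.2

lemma differentiableAt_extendZero (a : smoothAlgebra U) (p : U) :
    DifferentiableAt ℝ (extendZero a.1) p.1 :=
  ((contDiffOn_extendZero a).contDiffAt (U.isOpen.mem_nhds p.2)).differentiableAt (by simp)

lemma extendZero_eventuallyEq {f : U → ℂ} {F : ℝ × ℝ → ℂ} (h : ∀ p : U, f p = F p) (p : U) :
    extendZero f =ᶠ[nhds p.1] F :=
  Filter.eventually_of_mem (U.isOpen.mem_nhds p.2) fun x hx => by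
    rw [extendZero_apply f hx]; exact h ⟨x, hx⟩

/-- Differentiation in the direction `w`, as a derivation of the algebra of smooth functions. -/
noncomputable def directionalDerivation (w : ℝ × ℝ) :
    Derivation ℂ (smoothAlgebra U) (smoothAlgebra U) :=
  Derivation.mk'
    { toFun := fun a => ⟨fun p => fderiv ℝ (extendZero a.1) p w, by
        refine (((contDiffOn_extendZero a).fderiv_of_isOpen U.isOpen (m := ∞) le_rfl).clm_apply
          (contDiffOn_const (c := w))).congr fun p hp => ?_
        rw [extendZero_apply _ hp]⟩
      map_add' := fun a b => by
        ext p
        change fderiv ℝ (extendZero (a.1 + b.1)) p w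
          = fderiv ℝ (extendZero a.1) p w + fderiv ℝ (extendZero b.1) p w
        rw [(extendZero_eventuallyEq (F := extendZero a.1 + extendZero b.1) (fun p => by
          simp [extendZero_apply _ p.2]) p).fderiv_eq,
          fderiv_add (differentiableAt_extendZero a p) (differentiableAt_extendZero b p)]
        rfl
      map_smul' := fun c a => by
        ext p
        change fderiv ℝ (extendZero (c • a.1)) p w = c • fderiv ℝ (extendZero a.1) p w
        rw [(extendZero_eventuallyEq (F := c • extendZero a.1) (fun p => by
          simp [extendZero_apply _ p.2]) p).fderiv_eq,
          fderiv_const_smul (differentiableAt_extendZero a p)]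
        rfl }
    (fun a b => by
      ext p
      change fderiv ℝ (extendZero (a.1 * b.1)) p w
        = a.1 p * fderiv ℝ (extendZero b.1) p w + b.1 p * fderiv ℝ (extendZero a.1) p w
      rw [(extendZero_eventuallyEq (F := extendZero a.1 * extendZero b.1) (fun p => by
          simp [extendZero_apply _ p.2]) p).fderiv_eq,
        fderiv_mul (differentiableAt_extendZero a p) (differentiableAt_extendZero b p)]
      simp [extendZero_apply _ p.2])

lemma directionalDerivation_apply (w : ℝ × ℝ) (a : smoothAlgebra U) (p : U) :
    (directionalDerivation w a).1 p = fderiv ℝ (extendZero a.1) p w := rfl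

/-- Partial derivatives commute. -/
lemma directionalDerivation_comm (w w' : ℝ × ℝ) (a : smoothAlgebra U) :
    directionalDerivation w (directionalDerivation w' a)
      = directionalDerivation w' (directionalDerivation w a) := by
  have key : ∀ (w w' : ℝ × ℝ) (p : U), (directionalDerivation w (directionalDerivation w' a)).1 p
      = fderiv ℝ (fderiv ℝ (extendZero a.1)) p w w' := by
    intro w w' p
    have hd : DifferentiableAt ℝ (fderiv ℝ (extendZero a.1)) p.1 :=
      (((contDiffOn_extendZero a).fderiv_of_isOpen U.isOpen (m := ∞) le_rfl).contDiffAt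
        (U.isOpen.mem_nhds p.2)).differentiableAt (by simp)
    rw [directionalDerivation_apply, (extendZero_eventuallyEq
      (f := (directionalDerivation w' a).1)
      (F := fun p => fderiv ℝ (extendZero a.1) p w') (fun p => rfl) p).fderiv_eq,
      fderiv_clm_apply hd (differentiableAt_const w')]
    simp
  ext p
  rw [key, key]
  exact (((contDiffOn_extendZero a).contDiffAt (U.isOpen.mem_nhds p.2)).isSymmSndFDerivAt
    (by
      rw [minSmoothness_of_isRCLikeNormedField]
      exact WithTop.coe_le_coe.mpr (le_top (a := (2 : ℕ∞))))).eq w w'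

variable (U) in
/-- The partial derivative in `x`. -/
noncomputable def partialX : Derivation ℂ (smoothAlgebra U) (smoothAlgebra U) :=
  directionalDerivation (1, 0)

variable (U) in
/-- The partial derivative in `t`. -/
noncomputable def partialT : Derivation ℂ (smoothAlgebra U) (smoothAlgebra U) :=
  directionalDerivation (0, 1)

variable (U) in
/-- Constant functions on `U`. -/
def const (z : ℂ) : smoothAlgebra U := algebraMap ℂ _ z

/-- Evaluation at a point of `U`. -/
def evalAt (p : U) : smoothAlgebra U →+* ℂ :=
  (Pi.evalRingHom (fun _ : U => ℂ) p).comp (smoothAlgebra U).val.toRingHom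

@[simp]
lemma evalAt_const (p : U) (z : ℂ) : evalAt p (const U z) = z := rfl

lemma evalAt_ext {a b : smoothAlgebra U} (h : ∀ p, evalAt p a = evalAt p b) : a = b :=
  Subtype.ext (funext h)

lemma isUnit_of_evalAt_ne_zero {a : smoothAlgebra U} (h : ∀ p, evalAt p a ≠ 0) : IsUnit a := by
  have hinv : (fun p => (a.1 p)⁻¹) ∈ smoothAlgebra U :=
    (ContDiffOn.inv (contDiffOn_extendZero a) fun p hp => by
      rw [extendZero_apply _ hp]; exact h ⟨p, hp⟩).congr fun p hp => by
        rw [extendZero_apply _ hp, Pi.inv_apply, extendZero_apply _ hp]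
  exact .of_mul_eq_one ⟨_, hinv⟩ (evalAt_ext fun p => mul_inv_cancel₀ (h p))

/-- The field `f` restricts to the smooth function `a` on `U`. -/
def Represents (f : Field) (a : smoothAlgebra U) : Prop :=
  ∀ p : U, f p.1.1 p.1.2 = evalAt p a

lemma Represents.smooth {f : Field} {a : smoothAlgebra U} (h : Represents f a) : Smooth U f :=
  (contDiffOn_extendZero a).congr fun p hp => by
    rw [extendZero_apply _ hp]; exact h ⟨p, hp⟩

lemma exists_represents {f : Field} {Ω : Set (ℝ × ℝ)} (hf : Smooth Ω f)
    (hU : (U : Set (ℝ × ℝ)) ⊆ Ω) :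
    ∃ a : smoothAlgebra U, Represents f a :=
  ⟨⟨fun p => f p.1.1 p.1.2, (ContDiffOn.mono hf hU).congr fun _ hp => extendZero_apply _ hp⟩,
    fun _ => rfl⟩

/-- The field, zero outside `U`, of a smooth function on `U`. -/
noncomputable def toField (a : smoothAlgebra U) : Field := fun x t => extendZero a.1 (x, t)

lemma represents_toField (a : smoothAlgebra U) : Represents (toField a) a :=
  fun p => extendZero_apply a.1 p.2

lemma Represents.dx {f : Field} {a : smoothAlgebra U} (h : Represents f a) :
    Represents (dx f) (partialX U a) := by
  rintro ⟨⟨x, t⟩, hp⟩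
  have hd := (differentiableAt_extendZero a ⟨(x, t), hp⟩).hasFDerivAt.congr_of_eventuallyEq
    (extendZero_eventuallyEq (F := fun p : ℝ × ℝ => f p.1 p.2) (fun p => (h p).symm)
      ⟨(x, t), hp⟩).symm
  have hc : HasDerivAt (fun s : ℝ => (s, t)) ((1 : ℝ), (0 : ℝ)) x :=
    (hasDerivAt_id x).prodMk (hasDerivAt_const x t)
  exact (HasFDerivAt.comp_hasDerivAt x hd hc).deriv

lemma Represents.dt {f : Field} {a : smoothAlgebra U} (h : Represents f a) :
    Represents (dt f) (partialT U a) := by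
  rintro ⟨⟨x, t⟩, hp⟩
  have hd := (differentiableAt_extendZero a ⟨(x, t), hp⟩).hasFDerivAt.congr_of_eventuallyEq
    (extendZero_eventuallyEq (F := fun p : ℝ × ℝ => f p.1 p.2) (fun p => (h p).symm)
      ⟨(x, t), hp⟩).symm
  have hc : HasDerivAt (fun s : ℝ => (x, s)) ((0 : ℝ), (1 : ℝ)) t :=
    (hasDerivAt_const t x).prodMk (hasDerivAt_id t)
  exact (HasFDerivAt.comp_hasDerivAt t hd hc).deriv

end SmoothFunctions

/-! ### From smooth functions to values -/

section Evaluation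

variable {U : TopologicalSpace.Opens (ℝ × ℝ)}

/-- The conjugation by `diag(1, l)` that turns the polynomial matrices in `l²` back into the
original ones. -/
noncomputable def conjDiag (l : ℂ) (A : Matrix (Fin 2) (Fin 2) ℂ) : Matrix (Fin 2) (Fin 2) ℂ :=
  !![A 0 0, l * A 0 1; A 1 0 / l, A 1 1]

lemma conjDiag_mul {l : ℂ} (hl : l ≠ 0) (A B : Matrix (Fin 2) (Fin 2) ℂ) :
    conjDiag l (A * B) = conjDiag l A * conjDiag l B := by
  ext j k
  fin_cases j <;> fin_cases k <;>
    simp [conjDiag, Matrix.mul_apply, Fin.sum_univ_two] <;> field_simp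

lemma conjDiag_add (l : ℂ) (A B : Matrix (Fin 2) (Fin 2) ℂ) :
    conjDiag l (A + B) = conjDiag l A + conjDiag l B := by
  ext j k
  fin_cases j <;> fin_cases k <;> simp [conjDiag, mul_add, add_div]

lemma conjDiag_smul (l y : ℂ) (A : Matrix (Fin 2) (Fin 2) ℂ) :
    conjDiag l (y • A) = y • conjDiag l A := by
  ext j k
  fin_cases j <;> fin_cases k <;> simp [conjDiag, mul_left_comm, mul_div_assoc]

section Homomorphisms

variable {K : Type*} [CommRing K] [Algebra ℂ K] {Dx Dt : Derivation ℂ K K} {i ρ' h q' r' : K}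
  {q r : Field} {ρ : ℝ} {x t : ℝ}

lemma map_coupledQ (e : K →+* ℂ) (hi : e i = Complex.I) (hρ : e ρ' = ρ) (hh : e h = 1 / 2)
    (h0 : e q' = q x t) (h1 : e r' = r x t) (h2 : e (Dx q') = dx q x t)
    (h3 : e (Dx r') = dx r x t) (h4 : e (Dx (Dx q')) = dx (dx q) x t)
    (h5 : e (Dx (Dx (Dx q'))) = dx (dx (dx q)) x t) (h6 : e (Dt q') = dt q x t) :
    e (coupledQ Dx Dt i ρ' h q' r')
    = Complex.I * dt q x t + Complex.I * dx (dx (dx q)) x t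
      + (3 * q x t * r x t + 2 * ρ) * dx (dx q) x t
      + 3 * r x t * (dx q x t) ^ 2
      + 1 / 2 * (-9 * Complex.I * (q x t) ^ 2 * (r x t) ^ 2
          - 20 * Complex.I * ρ * q x t * r x t + 8 * Complex.I * ρ ^ 2
          + 6 * q x t * dx r x t) * dx q x t
      + Complex.I * (-3 * (q x t) ^ 3 * r x t - 2 * ρ * (q x t) ^ 2) * dx r x t
      - 3 * ρ * (r x t) ^ 2 * (q x t) ^ 3
      - 4 * ρ ^ 2 * r x t * (q x t) ^ 2
      + 8 * (ρ ^ 3 - ρ ^ 2) * q x t := by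
  simp only [coupledQ, map_add, map_sub, map_mul, map_neg, map_pow, map_ofNat, hi, hρ, hh, h0, h1,
    h2, h3, h4, h5, h6]

lemma map_coupledR (e : K →+* ℂ) (hi : e i = Complex.I) (hρ : e ρ' = ρ) (hh : e h = 1 / 2)
    (h0 : e q' = q x t) (h1 : e r' = r x t) (h2 : e (Dx q') = dx q x t)
    (h3 : e (Dx r') = dx r x t) (h4 : e (Dx (Dx r')) = dx (dx r) x t)
    (h5 : e (Dx (Dx (Dx r'))) = dx (dx (dx r)) x t) (h6 : e (Dt r') = dt r x t) :
    e (coupledR Dx Dt i ρ' h q' r')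
    = Complex.I * dt r x t + Complex.I * dx (dx (dx r)) x t
      - (3 * q x t * r x t + 2 * ρ) * dx (dx r) x t
      - 3 * q x t * (dx r x t) ^ 2
      + 1 / 2 * (-9 * Complex.I * (q x t) ^ 2 * (r x t) ^ 2
          - 20 * Complex.I * ρ * q x t * r x t + 8 * Complex.I * ρ ^ 2
          - 6 * r x t * dx q x t) * dx r x t
      + Complex.I * (-3 * (r x t) ^ 3 * q x t - 2 * ρ * (r x t) ^ 2) * dx q x t
      + 3 * ρ * (r x t) ^ 3 * (q x t) ^ 2
      + 4 * ρ ^ 2 * (r x t) ^ 2 * q x t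
      + 8 * (-ρ ^ 3 + ρ ^ 2) * r x t := by
  simp only [coupledR, map_add, map_sub, map_mul, map_neg, map_pow, map_ofNat, hi, hρ, hh, h0, h1,
    h2, h3, h4, h5, h6]

lemma smul_laxP_eq {K : Type*} [CommRing K] {i ρ' q' r' : K} (E : K[X] →+* ℂ) {l : ℂ}
    (hl : l ≠ 0) (hX : E X = l ^ 2) (hi : E (C i) = Complex.I)
    (hρ : E (C ρ') = ρ) (h0 : E (C q') = q x t) (h1 : E (C r') = r x t) :
    (l ^ 2) ^ 1 • laxP ρ q r l x t = conjDiag l ((polyP i ρ' q' r').map E) := by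
  ext j k
  fin_cases j <;> fin_cases k <;>
    simp only [laxP, conjDiag, polyP, Matrix.of_apply,
      Matrix.cons_val', Matrix.cons_val_zero, Matrix.cons_val_one, Matrix.cons_val_fin_one,
      Matrix.map_apply, Matrix.smul_apply, map_add, map_sub, map_mul, map_neg,
      hX, hi, hρ, h0, h1, smul_eq_mul, Fin.zero_eta, Fin.mk_one] <;>
    field_simp

lemma smul_laxQ_eq (E : K[X] →+* ℂ) {l : ℂ} (hl : l ≠ 0) (hX : E X = l ^ 2)
    (hi : E (C i) = Complex.I)
    (hρ : E (C ρ') = ρ) (hh : E (C h) = 1 / 2) (h0 : E (C q') = q x t) (h1 : E (C r') = r x t)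
    (h2 : E (C (Dx q')) = dx q x t) (h3 : E (C (Dx r')) = dx r x t)
    (h4 : E (C (Dx (Dx q'))) = dx (dx q) x t) (h5 : E (C (Dx (Dx r'))) = dx (dx r) x t) :
    (l ^ 2) ^ 3 • laxQ ρ q r l x t = conjDiag l ((polyQ Dx i ρ' h q' r').map E) := by
  ext j k
  fin_cases j <;> fin_cases k <;>
    simp only [laxQ, laxQ1, laxQ2, laxQ3, conjDiag, polyQ, Matrix.of_apply,
      Matrix.cons_val', Matrix.cons_val_zero, Matrix.cons_val_one, Matrix.cons_val_fin_one,
      Matrix.map_apply, Matrix.smul_apply, map_add, map_sub, map_mul, map_neg, map_pow, map_ofNat,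
      hX, hi, hρ, hh, h0, h1, h2, h3, h4, h5, smul_eq_mul, Fin.zero_eta, Fin.mk_one] <;>
    field_simp
  all_goals ring

end Homomorphisms

/-- The value at the point `p` and at `X = l²` of a polynomial with smooth coefficients. -/
noncomputable def evalPoly (p : U) (l : ℂ) : (smoothAlgebra U)[X] →+* ℂ :=
  (evalAt p).comp (evalRingHom (const U (l ^ 2)))

lemma evalPoly_apply (p : U) (l : ℂ) (f : (smoothAlgebra U)[X]) :
    evalPoly p l f = evalAt p (f.eval (const U (l ^ 2))) := rfl

@[simp]
lemma evalPoly_C (p : U) (l : ℂ) (y : smoothAlgebra U) : evalPoly p l (C y) = evalAt p y := by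
  rw [evalPoly_apply, eval_C]

@[simp]
lemma evalPoly_X (p : U) (l : ℂ) : evalPoly p l X = l ^ 2 := by
  rw [evalPoly_apply, eval_X, evalAt_const]

/-- A gauge relation of polynomial matrices, evaluated at a point and at `X = l²` and conjugated
back, is a gauge relation of the original matrices. -/
lemma IsGauge.evalPoly {D : Derivation ℂ (smoothAlgebra U) (smoothAlgebra U)} {s : ℕ}
    {T L M : Matrix (Fin 2) (Fin 2) (smoothAlgebra U)[X]} (h : IsGauge D s T L M) (p : U)
    {l : ℂ} (hl : l ≠ 0) {T₀ T' L₀ M₀ : Matrix (Fin 2) (Fin 2) ℂ}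
    (hT : T₀ = conjDiag l (T.map (evalPoly p l)))
    (hT' : T' = conjDiag l (T.map fun f => evalPoly p l (coeffwise D f)))
    (hL : (l ^ 2) ^ s • L₀ = conjDiag l (L.map (evalPoly p l)))
    (hM : (l ^ 2) ^ s • M₀ = conjDiag l (M.map (evalPoly p l))) :
    T' + T₀ * L₀ = M₀ * T₀ := by
  have key : (l ^ 2) ^ s • (T.map fun f => SelfSteepening.evalPoly p l (coeffwise D f))
      + T.map (SelfSteepening.evalPoly p l) * L.map (SelfSteepening.evalPoly p l)
      = M.map (SelfSteepening.evalPoly p l) * T.map (SelfSteepening.evalPoly p l) := by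
    ext j k
    have := congrArg (SelfSteepening.evalPoly p l) (h j k)
    simpa [Matrix.mul_apply, Fin.sum_univ_two] using this
  have hne : (l ^ 2) ^ s ≠ 0 := pow_ne_zero _ (pow_ne_zero _ hl)
  have := congrArg (conjDiag l) key
  rw [conjDiag_add, conjDiag_mul hl, conjDiag_mul hl, conjDiag_smul, ← hT, ← hT', ← hL, ← hM,
    Matrix.mul_smul, Matrix.smul_mul, ← smul_add] at this
  exact smul_right_injective _ hne this

/-- The ring elements that stand for `i`, `ρ` and `1 / 2`. -/
lemma isConstants (ρ : ℝ) : IsConstants (partialX U) (partialT U) (const U Complex.I) (const U ρ)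
    (const U (1 / 2)) where
  sq := evalAt_ext fun p => by
    rw [map_pow, evalAt_const, Complex.I_sq, map_neg, map_one]
  two_mul := evalAt_ext fun p => by
    rw [map_mul, map_ofNat, evalAt_const, map_one, mul_one_div_cancel two_ne_zero]
  dx_i := Derivation.map_algebraMap _ _
  dx_ρ := Derivation.map_algebraMap _ _
  dx_h := Derivation.map_algebraMap _ _
  dt_i := Derivation.map_algebraMap _ _
  dt_ρ := Derivation.map_algebraMap _ _

variable {q r : Field} {q' r' : smoothAlgebra U}

lemma IsCoupledSolution.coupled_eq_zero (hq : Represents q q') (hr : Represents r r') {ρ : ℝ}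
    {Ω : Set (ℝ × ℝ)} (hU : (U : Set (ℝ × ℝ)) ⊆ Ω) (h : IsCoupledSolution ρ Ω q r) :
    coupledQ (partialX U) (partialT U)
      (const U Complex.I) (const U ρ) (const U (1 / 2)) q' r' = 0 ∧
    coupledR (partialX U) (partialT U)
      (const U Complex.I) (const U ρ) (const U (1 / 2)) q' r' = 0 := by
  constructor <;> refine evalAt_ext fun p => ?_ <;> rw [map_zero]
  · exact (map_coupledQ (evalAt p) rfl rfl rfl (hq p).symm (hr p).symm (hq.dx p).symm
      (hr.dx p).symm (hq.dx.dx p).symm (hq.dx.dx.dx p).symm (hq.dt p).symm).trans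
        (h.eq_q _ _ (hU p.2))
  · exact (map_coupledR (evalAt p) rfl rfl rfl (hq p).symm (hr p).symm (hq.dx p).symm
      (hr.dx p).symm (hr.dx.dx p).symm (hr.dx.dx.dx p).symm (hr.dt p).symm).trans
        (h.eq_r _ _ (hU p.2))

lemma isCoupledSolution_of_coupled_eq_zero (hq : Represents q q') (hr : Represents r r') {ρ : ℝ}
    (h : coupledQ (partialX U) (partialT U)
      (const U Complex.I) (const U ρ) (const U (1 / 2)) q' r' = 0)
    (h' : coupledR (partialX U) (partialT U)
      (const U Complex.I) (const U ρ) (const U (1 / 2)) q' r' = 0) :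
    IsCoupledSolution ρ U q r where
  smooth_q := hq.smooth
  smooth_r := hr.smooth
  eq_q x t hp := by
    have := map_coupledQ (Dx := partialX U) (Dt := partialT U) (i := const U Complex.I)
      (ρ' := const U ρ) (h := const U (1 / 2)) (evalAt ⟨(x, t), hp⟩) rfl rfl rfl (hq _).symm
      (hr _).symm (hq.dx _).symm (hr.dx _).symm (hq.dx.dx _).symm (hq.dx.dx.dx _).symm
      (hq.dt _).symm
    rw [h, map_zero] at this
    exact this.symm
  eq_r x t hp := by
    have := map_coupledR (Dx := partialX U) (Dt := partialT U) (i := const U Complex.I)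
      (ρ' := const U ρ) (h := const U (1 / 2)) (evalAt ⟨(x, t), hp⟩) rfl rfl rfl (hq _).symm
      (hr _).symm (hq.dx _).symm (hr.dx _).symm (hr.dx.dx _).symm (hr.dx.dx.dx _).symm
      (hr.dt _).symm
    rw [h', map_zero] at this
    exact this.symm

lemma smul_laxP (hq : Represents q q') (hr : Represents r r') (ρ : ℝ) {l : ℂ} (hl : l ≠ 0)
    {x t : ℝ} (hp : (x, t) ∈ U) :
    (l ^ 2) ^ 1 • laxP ρ q r l x t = conjDiag l ((polyP (const U Complex.I)
      (const U ρ) q' r').map (evalPoly ⟨(x, t), hp⟩ l)) := by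
  have hC := evalPoly_C ⟨(x, t), hp⟩ l
  exact smul_laxP_eq _ hl (evalPoly_X _ _) (hC _) (hC _) ((hC _).trans (hq _).symm)
    ((hC _).trans (hr _).symm)

lemma smul_laxQ (hq : Represents q q') (hr : Represents r r') (ρ : ℝ) {l : ℂ} (hl : l ≠ 0)
    {x t : ℝ} (hp : (x, t) ∈ U) :
    (l ^ 2) ^ 3 • laxQ ρ q r l x t = conjDiag l ((polyQ (partialX U)
      (const U Complex.I) (const U ρ) (const U (1 / 2)) q' r').map
        (evalPoly ⟨(x, t), hp⟩ l)) := by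
  have hC := evalPoly_C ⟨(x, t), hp⟩ l
  exact smul_laxQ_eq _ hl (evalPoly_X _ _) (hC _) (hC _) (hC _) ((hC _).trans (hq _).symm)
    ((hC _).trans (hr _).symm) ((hC _).trans (hq.dx _).symm) ((hC _).trans (hr.dx _).symm)
    ((hC _).trans (hq.dx.dx _).symm) ((hC _).trans (hr.dx.dx _).symm)

end Evaluation

/-! ### Determinants and the Darboux matrix as smooth functions -/

section Determinants

variable {U : TopologicalSpace.Opens (ℝ × ℝ)} {N : ℕ} (lam : Fin (2 * N) → ℂ)
  {φ₁ φ₂ : Fin (2 * N) → Field} {f₁ f₂ : Fin (2 * N) → smoothAlgebra U}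

lemma map_ringB12 (h₁ : ∀ k, Represents (φ₁ k) (f₁ k)) (h₂ : ∀ k, Represents (φ₂ k) (f₂ k))
    (p : U) : (ringB12 N (fun k => const U (lam k)) f₁ f₂).map (evalAt p)
      = B12 N lam φ₁ φ₂ p.1.1 p.1.2 := by
  ext k c
  simp only [Matrix.map_apply, ringB12, B12, Matrix.of_apply, h₁ k p, h₂ k p]
  split_ifs <;> simp only [map_mul, map_pow, evalAt_const]

lemma map_ringB22 (h₁ : ∀ k, Represents (φ₁ k) (f₁ k)) (h₂ : ∀ k, Represents (φ₂ k) (f₂ k))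
    (p : U) : (ringB22 N (fun k => const U (lam k)) f₁ f₂).map (evalAt p)
      = B22 N lam φ₁ φ₂ p.1.1 p.1.2 := by
  ext k c
  simp only [Matrix.map_apply, ringB22, B22, Matrix.of_apply, h₁ k p, h₂ k p]
  split_ifs <;> simp only [map_mul, map_pow, evalAt_const]

lemma represents_det_B12 (h₁ : ∀ k, Represents (φ₁ k) (f₁ k))
    (h₂ : ∀ k, Represents (φ₂ k) (f₂ k)) :
    Represents (fun x t => (B12 N lam φ₁ φ₂ x t).det)
      (ringB12 N (fun k => const U (lam k)) f₁ f₂).det :=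
  fun p => by
    beta_reduce
    rw [← map_ringB12 lam h₁ h₂]
    exact ((evalAt p).map_det _).symm

lemma represents_det_B22 (h₁ : ∀ k, Represents (φ₁ k) (f₁ k))
    (h₂ : ∀ k, Represents (φ₂ k) (f₂ k)) :
    Represents (fun x t => (B22 N lam φ₁ φ₂ x t).det)
      (ringB22 N (fun k => const U (lam k)) f₁ f₂).det :=
  fun p => by
    beta_reduce
    rw [← map_ringB22 lam h₁ h₂]
    exact ((evalAt p).map_det _).symm

lemma represents_det_B11 (hN : 0 < N) (h₁ : ∀ k, Represents (φ₁ k) (f₁ k))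
    (h₂ : ∀ k, Represents (φ₂ k) (f₂ k)) :
    Represents (fun x t => (B11 N lam φ₁ φ₂ x t).det)
      ((ringB12 N (fun k => const U (lam k)) f₁ f₂).updateCol ⟨1, by omega⟩
        fun k => -const U (lam k) ^ (2 * N) * f₁ k).det := by
  intro p
  refine Eq.trans (congrArg Matrix.det ?_) ((evalAt p).map_det _).symm
  ext k c
  have := congrFun (congrFun (map_ringB12 lam h₁ h₂ p) k) c
  simp only [Matrix.map_apply] at this
  simp only [B11, Matrix.of_apply, RingHom.mapMatrix_apply, Matrix.map_apply,
    Matrix.updateCol_apply, Fin.ext_iff, ← this, h₁ k p]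
  split_ifs <;> simp only [map_mul, map_pow, map_neg, evalAt_const]

lemma represents_det_B21 (hN : 0 < N) (h₁ : ∀ k, Represents (φ₁ k) (f₁ k))
    (h₂ : ∀ k, Represents (φ₂ k) (f₂ k)) :
    Represents (fun x t => (B21 N lam φ₁ φ₂ x t).det)
      ((ringB22 N (fun k => const U (lam k)) f₁ f₂).updateCol ⟨0, by omega⟩
        fun k => -const U (lam k) ^ (2 * N) * f₂ k).det := by
  intro p
  refine Eq.trans (congrArg Matrix.det ?_) ((evalAt p).map_det _).symm
  ext k c
  have := congrFun (congrFun (map_ringB22 lam h₁ h₂ p) k) c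
  simp only [Matrix.map_apply] at this
  simp only [B21, Matrix.of_apply, RingHom.mapMatrix_apply, Matrix.map_apply,
    Matrix.updateCol_apply, Fin.ext_iff, ← this, h₂ k p]
  split_ifs <;> simp only [map_mul, map_pow, map_neg, evalAt_const]

lemma isOpen_regularSet {Ω : Set (ℝ × ℝ)} (hΩ : IsOpen Ω)
    (h₁ : ∀ k, Smooth Ω (φ₁ k)) (h₂ : ∀ k, Smooth Ω (φ₂ k)) :
    IsOpen (regularSet N lam φ₁ φ₂ Ω) := by
  choose f₁ hf₁ using fun k => exists_represents (U := ⟨Ω, hΩ⟩) (h₁ k) le_rfl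
  choose f₂ hf₂ using fun k => exists_represents (U := ⟨Ω, hΩ⟩) (h₂ k) le_rfl
  have c1 := (represents_det_B12 lam hf₁ hf₂).smooth.continuousOn.isOpen_inter_preimage hΩ
    isOpen_compl_singleton (t := {0}ᶜ)
  have c2 := (represents_det_B22 lam hf₁ hf₂).smooth.continuousOn.isOpen_inter_preimage hΩ
    isOpen_compl_singleton (t := {0}ᶜ)
  have hc := c1.inter c2
  rw [← Set.inter_inter_distrib_left] at hc
  exact hc

end Determinants

section DarbouxMatrix

variable {U : TopologicalSpace.Opens (ℝ × ℝ)} {N : ℕ} {a b c d : (smoothAlgebra U)[X]}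

/-- The field that is the `j`-th coefficient of `a`. -/
noncomputable def coeffField (a : (smoothAlgebra U)[X]) (j : ℕ) : Field := toField (a.coeff j)

lemma represents_sum_coeffField (ha : a ∈ degreeLT (smoothAlgebra U) N) (l : ℂ) :
    Represents (fun x t => ∑ j ∈ Finset.range N, coeffField a j x t * l ^ (2 * j))
      (a.eval (const U (l ^ 2))) := by
  intro p
  rw [eval_eq_sum_range_of_mem_degreeLT ha, map_sum]
  refine Finset.sum_congr rfl fun j _ => ?_
  rw [map_mul, map_pow, evalAt_const, ← pow_mul]
  exact congrArg (· * l ^ (2 * j)) (represents_toField (a.coeff j) p)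

/-- Conjugation by `diag(1, l)` multiplies the entries of `darbouxPoly` at `X = l²` by the entries
of the constant matrix in the statement. -/
lemma represents_darbouxMatrix {m u v : Fin (2 * N) → smoothAlgebra U}
    (h : IsDarbouxPolynomial N m u v a b c d) {l : ℂ} (hl : l ≠ 0) (j k : Fin 2) :
    Represents (fun x t => darbouxMatrix N (coeffField a) (coeffField b) (coeffField c)
      (coeffField d) l x t j k)
      ((!![1, const U l; const U l⁻¹, 1] : Matrix (Fin 2) (Fin 2) _) j k *
        (darbouxPoly N a b c d j k).eval (const U (l ^ 2))) := by
  intro p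
  have ha := represents_sum_coeffField h.deg_a l p
  have hb := represents_sum_coeffField h.deg_b l p
  have hc := represents_sum_coeffField h.deg_c l p
  have hd := represents_sum_coeffField h.deg_d l p
  simp only at ha hb hc hd
  fin_cases j <;> fin_cases k
  · simp only [darbouxMatrix, darbouxPoly, Matrix.of_apply, Matrix.cons_val', Matrix.cons_val_zero,
      Matrix.cons_val_fin_one, Fin.zero_eta, ha, one_mul, eval_add, eval_pow, eval_X, map_add,
      map_pow, evalAt_const, ← pow_mul]
  · simp only [darbouxMatrix, darbouxPoly, Matrix.of_apply, Matrix.cons_val', Matrix.cons_val_zero,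
      Matrix.cons_val_one, Matrix.cons_val_fin_one, Fin.zero_eta, Fin.mk_one, map_mul,
      evalAt_const, ← hb, Finset.mul_sum]
    exact Finset.sum_congr rfl fun j _ => by ring
  · simp only [darbouxMatrix, darbouxPoly, Matrix.of_apply, Matrix.cons_val', Matrix.cons_val_zero,
      Matrix.cons_val_one, Matrix.cons_val_fin_one, Fin.zero_eta, Fin.mk_one, map_mul, eval_mul,
      eval_X, evalAt_const, ← hc, Finset.mul_sum]
    have hl' : l⁻¹ * l ^ 2 = l := by rw [pow_two, inv_mul_cancel_left₀ hl]
    exact Finset.sum_congr rfl fun j _ => by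
      linear_combination -(coeffField c j p.1.1 p.1.2 * l ^ (2 * j)) * hl'
  · simp only [darbouxMatrix, darbouxPoly, Matrix.of_apply, Matrix.cons_val',
      Matrix.cons_val_one, Matrix.cons_val_fin_one, Fin.mk_one, hd, one_mul, eval_add, eval_pow,
      eval_X, map_add, map_pow, evalAt_const, ← pow_mul]

end DarbouxMatrix

/-! ### The coupled system -/

section CoupledSystem

variable {U : TopologicalSpace.Opens (ℝ × ℝ)} {N : ℕ}

lemma const_pow (l : ℂ) (n : ℕ) : const U (l ^ n) = const U l ^ n := map_pow _ _ _

lemma isUnit_const {l : ℂ} (hl : l ≠ 0) : IsUnit (const U l) := hl.isUnit.map (algebraMap ℂ _)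

/-- A linear equation for `(φ₁, φ₂)` whose matrix comes from the polynomial matrix `L` becomes,
for `u = φ₁` and `v = l φ₂`, the equation with matrix `L`. -/
lemma lax_equation {D : Derivation ℂ (smoothAlgebra U) (smoothAlgebra U)} {s : ℕ}
    {L : Matrix (Fin 2) (Fin 2) (smoothAlgebra U)[X]} {φ₁ φ₂ φ₁' φ₂' : Field}
    {f₁ f₂ : smoothAlgebra U} {l : ℂ} (hl : l ≠ 0) {L₀ : ℝ → ℝ → Matrix (Fin 2) (Fin 2) ℂ}
    (h₁ : Represents φ₁ f₁) (h₂ : Represents φ₂ f₂) (h₁' : Represents φ₁' (D f₁))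
    (h₂' : Represents φ₂' (D f₂))
    (h : ∀ x t, (x, t) ∈ U → ![φ₁' x t, φ₂' x t] = (L₀ x t).mulVec ![φ₁ x t, φ₂ x t])
    (hL : ∀ x t (hp : (x, t) ∈ U),
      (l ^ 2) ^ s • L₀ x t = conjDiag l (L.map (evalPoly ⟨(x, t), hp⟩ l))) :
    (const U l ^ 2) ^ s * D f₁
      = (L 0 0).eval (const U l ^ 2) * f₁ + (L 0 1).eval (const U l ^ 2) * (const U l * f₂) ∧
    (const U l ^ 2) ^ s * D (const U l * f₂)
      = (L 1 0).eval (const U l ^ 2) * f₁ + (L 1 1).eval (const U l ^ 2) * (const U l * f₂) := by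
  have hD : D (const U l) = 0 := D.map_algebraMap l
  have key : ∀ x t (hp : (x, t) ∈ U), (l ^ 2) ^ s • ![φ₁' x t, φ₂' x t]
      = (conjDiag l (L.map (evalPoly ⟨(x, t), hp⟩ l))).mulVec ![φ₁ x t, φ₂ x t] := by
    intro x t hp
    rw [h x t hp, ← hL x t hp, Matrix.smul_mulVec]
  constructor <;> refine evalAt_ext ?_ <;> rintro ⟨⟨x, t⟩, hp⟩
  · have := congrFun (key x t hp) 0
    simp only [conjDiag, Matrix.mulVec, dotProduct, Fin.sum_univ_two, Pi.smul_apply, smul_eq_mul,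
      Matrix.of_apply, Matrix.cons_val', Matrix.cons_val_zero, Matrix.cons_val_one,
      Matrix.cons_val_fin_one, Matrix.map_apply, evalPoly_apply, const_pow, h₁ ⟨_, hp⟩,
      h₂ ⟨_, hp⟩, h₁' ⟨_, hp⟩] at this
    simp only [map_mul, map_add, map_pow, evalAt_const] at this ⊢
    linear_combination this
  · have := congrFun (key x t hp) 1
    simp only [conjDiag, Matrix.mulVec, dotProduct, Fin.sum_univ_two, Pi.smul_apply, smul_eq_mul,
      Matrix.of_apply, Matrix.cons_val', Matrix.cons_val_zero, Matrix.cons_val_one,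
      Matrix.cons_val_fin_one, Matrix.map_apply, evalPoly_apply, const_pow, h₁ ⟨_, hp⟩,
      h₂ ⟨_, hp⟩, h₂' ⟨_, hp⟩] at this
    simp only [D.leibniz, hD, smul_eq_mul, mul_zero, add_zero, map_mul, map_add, map_pow,
      evalAt_const] at this ⊢
    rw [div_mul_eq_mul_div, ← sub_eq_iff_eq_add, eq_div_iff hl] at this
    linear_combination this

lemma represents_div {f g : Field} {a b y : smoothAlgebra U} (hf : Represents f a)
    (hg : Represents g b) (hb : ∀ x t, (x, t) ∈ U → g x t ≠ 0) (h : y * b = a) :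
    Represents (fun x t => f x t / g x t) y := by
  intro p
  change f p.1.1 p.1.2 / g p.1.1 p.1.2 = _
  rw [div_eq_iff (hb _ _ p.2), hf p, hg p, ← h, map_mul]

variable {lam : Fin (2 * N) → ℂ} {φ₁ φ₂ : Fin (2 * N) → Field}
  {f₁ f₂ : Fin (2 * N) → smoothAlgebra U} {a b c d : (smoothAlgebra U)[X]}

lemma darbouxMatrix_eq_conjDiag {m u v : Fin (2 * N) → smoothAlgebra U}
    (h : IsDarbouxPolynomial N m u v a b c d) {l : ℂ} (hl : l ≠ 0) {x t : ℝ} (hp : (x, t) ∈ U) :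
    darbouxMatrix N (coeffField a) (coeffField b) (coeffField c) (coeffField d) l x t
      = conjDiag l ((darbouxPoly N a b c d).map (evalPoly ⟨(x, t), hp⟩ l)) := by
  ext j k
  refine (represents_darbouxMatrix h hl j k ⟨(x, t), hp⟩).trans ?_
  fin_cases j <;> fin_cases k <;>
    simp [conjDiag, evalPoly_apply, inv_mul_eq_div]

lemma derivative_darbouxMatrix_eq_conjDiag {m u v : Fin (2 * N) → smoothAlgebra U}
    (h : IsDarbouxPolynomial N m u v a b c d) {l : ℂ} (hl : l ≠ 0)
    {D : Derivation ℂ (smoothAlgebra U) (smoothAlgebra U)} {δ : Field → Field}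
    (hδ : ∀ {f : Field} {y : smoothAlgebra U}, Represents f y → Represents (δ f) (D y))
    {x t : ℝ} (hp : (x, t) ∈ U) :
    (Matrix.of fun j k => δ (fun x t => darbouxMatrix N (coeffField a) (coeffField b)
        (coeffField c) (coeffField d) l x t j k) x t)
      = conjDiag l ((darbouxPoly N a b c d).map
          fun f => evalPoly ⟨(x, t), hp⟩ l (coeffwise D f)) := by
  have hD : ∀ z, D (const U z) = 0 := D.map_algebraMap
  ext j k
  refine (hδ (represents_darbouxMatrix h hl j k) ⟨(x, t), hp⟩).trans ?_
  fin_cases j <;> fin_cases k <;>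
    simp [conjDiag, evalPoly_apply, inv_mul_eq_div, eval_coeffwise D (hD _), D.leibniz, hD,
      -coeffwise_mul]

lemma IsDarbouxPolynomial.isDarbouxMatrix
    (hT : IsDarbouxPolynomial N (fun k => const U (lam k) ^ 2) f₁
      (fun k => const U (lam k) * f₂ k) a b c d) (hlam : ∀ k, lam k ≠ 0) {q r q' r' : Field}
    {ρ : ℝ} {y z y' z' : smoothAlgebra U}
    (h₁ : ∀ k, Represents (φ₁ k) (f₁ k)) (h₂ : ∀ k, Represents (φ₂ k) (f₂ k))
    (hq : Represents q y) (hr : Represents r z) (hq' : Represents q' y') (hr' : Represents r' z')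
    (hP : IsGauge (partialX U) 1 (darbouxPoly N a b c d)
      (polyP (const U Complex.I) (const U ρ) y z) (polyP (const U Complex.I) (const U ρ) y' z'))
    (hQ : IsGauge (partialT U) 3 (darbouxPoly N a b c d)
      (polyQ (partialX U) (const U Complex.I) (const U ρ) (const U (1 / 2)) y z)
      (polyQ (partialX U) (const U Complex.I) (const U ρ) (const U (1 / 2)) y' z')) :
    IsDarbouxMatrix ρ U N lam φ₁ φ₂ q r q' r'
      (coeffField a) (coeffField b) (coeffField c) (coeffField d) where
  smooth j _ := ⟨(represents_toField _).smooth, (represents_toField _).smooth,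
    (represents_toField _).smooth, (represents_toField _).smooth⟩
  kernel k x t hp := by
    have e₁ := congrArg (evalAt ⟨(x, t), hp⟩) (hT.row₁ k)
    have e₂ := congrArg (evalAt ⟨(x, t), hp⟩) (hT.row₂ k)
    rw [darbouxMatrix_eq_conjDiag hT (hlam k) hp]
    simp only [map_add, map_mul, map_zero, evalAt_const, ← const_pow] at e₁ e₂
    ext j
    fin_cases j
    · simp only [conjDiag, darbouxPoly, Matrix.mulVec, dotProduct, Fin.sum_univ_two,
        Matrix.of_apply, Matrix.cons_val', Matrix.cons_val_zero, Matrix.cons_val_one,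
        Matrix.cons_val_fin_one, Matrix.map_apply, evalPoly_apply, h₁ k ⟨_, hp⟩, h₂ k ⟨_, hp⟩,
        Fin.zero_eta, Pi.zero_apply]
      linear_combination e₁
    · simp only [conjDiag, darbouxPoly, Matrix.mulVec, dotProduct, Fin.sum_univ_two,
        Matrix.of_apply, Matrix.cons_val', Matrix.cons_val_zero, Matrix.cons_val_one,
        Matrix.cons_val_fin_one, Matrix.map_apply, evalPoly_apply, h₁ k ⟨_, hp⟩, h₂ k ⟨_, hp⟩,
        Fin.mk_one, Pi.zero_apply]
      rw [div_mul_eq_mul_div, ← eq_neg_iff_add_eq_zero, div_eq_iff (hlam k)]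
      linear_combination e₂
  gauge_x l hl x t hp := hP.evalPoly ⟨(x, t), hp⟩ hl (darbouxMatrix_eq_conjDiag hT hl hp)
    (derivative_darbouxMatrix_eq_conjDiag hT hl Represents.dx hp) (smul_laxP hq hr ρ hl hp)
    (smul_laxP hq' hr' ρ hl hp)
  gauge_t l hl x t hp := hQ.evalPoly ⟨(x, t), hp⟩ hl (darbouxMatrix_eq_conjDiag hT hl hp)
    (derivative_darbouxMatrix_eq_conjDiag hT hl Represents.dt hp) (smul_laxQ hq hr ρ hl hp)
    (smul_laxQ hq' hr' ρ hl hp)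

/-- The `N`-fold Darboux transformation of the coupled system. -/
theorem IsCoupledSolution.darboux {ρ : ℝ} (hN : 0 < N) (hlam : ∀ k, lam k ≠ 0)
    {Ω : Set (ℝ × ℝ)} (hΩ : IsOpen Ω) {q r : Field} (h : IsCoupledSolution ρ Ω q r)
    (hφ : ∀ k, IsEigenfunction ρ Ω q r (lam k) (φ₁ k) (φ₂ k)) :
    IsCoupledSolution ρ (regularSet N lam φ₁ φ₂ Ω) (qN N lam φ₁ φ₂ ρ q) (rN N lam φ₁ φ₂ ρ r) ∧
      ∃ A₁ A₂ A₃ A₄ : ℕ → Field,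
        IsDarbouxMatrix ρ (regularSet N lam φ₁ φ₂ Ω) N lam φ₁ φ₂ q r (qN N lam φ₁ φ₂ ρ q)
          (rN N lam φ₁ φ₂ ρ r) A₁ A₂ A₃ A₄ ∧
        ∀ x t, (x, t) ∈ regularSet N lam φ₁ φ₂ Ω →
          A₂ (N - 1) x t = A2top N lam φ₁ φ₂ x t ∧ A₃ (N - 1) x t = A3top N lam φ₁ φ₂ x t := by
  obtain ⟨U, hU⟩ : ∃ U : TopologicalSpace.Opens (ℝ × ℝ),
      (U : Set (ℝ × ℝ)) = regularSet N lam φ₁ φ₂ Ω :=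
    ⟨⟨_, isOpen_regularSet lam hΩ (fun k => (hφ k).smooth₁) fun k => (hφ k).smooth₂⟩, rfl⟩
  have hUΩ : (U : Set (ℝ × ℝ)) ⊆ Ω := hU ▸ fun _ hp => hp.1
  have hU12 : ∀ x t, (x, t) ∈ U → (B12 N lam φ₁ φ₂ x t).det ≠ 0 := fun x t hp =>
    (hU.subset hp).2.1
  have hU22 : ∀ x t, (x, t) ∈ U → (B22 N lam φ₁ φ₂ x t).det ≠ 0 := fun x t hp =>
    (hU.subset hp).2.2
  obtain ⟨y, hy⟩ := exists_represents h.smooth_q hUΩ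
  obtain ⟨z, hz⟩ := exists_represents h.smooth_r hUΩ
  choose f₁ h₁ using fun k => exists_represents (hφ k).smooth₁ hUΩ
  choose f₂ h₂ using fun k => exists_represents (hφ k).smooth₂ hUΩ
  have r12 := represents_det_B12 lam h₁ h₂
  have r22 := represents_det_B22 lam h₁ h₂
  have hun := isUnisolvent_of_isUnit_det (fun k => isUnit_const (U := U) (hlam k))
    (isUnit_of_evalAt_ne_zero fun p h0 => hU12 _ _ p.2 ((r12 p).trans h0))
    (isUnit_of_evalAt_ne_zero fun p h0 => hU22 _ _ p.2 ((r22 p).trans h0))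
  obtain ⟨a, b, c, d, hT⟩ := hun.exists_isDarbouxPolynomial
  have hb : Represents (A2top N lam φ₁ φ₂) (b.coeff (N - 1)) :=
    represents_div (represents_det_B11 lam hN h₁ h₂) r12 hU12 (hT.coeff_b_mul_det hN)
  have hc : Represents (A3top N lam φ₁ φ₂) (c.coeff (N - 1)) :=
    represents_div (represents_det_B21 lam hN h₁ h₂) r22 hU22
      (hT.coeff_c_mul_det hN fun k => isUnit_const (hlam k))
  have hX := fun k => lax_equation (D := partialX U) (s := 1) (hlam k) (h₁ k) (h₂ k) (h₁ k).dx
    (h₂ k).dx (fun x t hp => (hφ k).eq_x x t (hUΩ hp)) fun x t hp => smul_laxP hy hz ρ (hlam k) hp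
  have hT' := fun k => lax_equation (D := partialT U) (s := 3) (hlam k) (h₁ k) (h₂ k) (h₁ k).dt
    (h₂ k).dt (fun x t hp => (hφ k).eq_t x t (hUΩ hp)) fun x t hp => smul_laxQ hy hz ρ (hlam k) hp
  have hm : ∀ D : Derivation ℂ (smoothAlgebra U) (smoothAlgebra U), ∀ k,
      D (const U (lam k) ^ 2) = 0 := fun D k => by
    rw [← const_pow]; exact D.map_algebraMap _
  have hP := hT.isGauge_polyP (q := y) (r := z) (i := const U Complex.I) (ρ := const U ρ) hN hun
    (hm _) (fun k => by simpa [polyP] using (hX k).1) (fun k => by simpa [polyP] using (hX k).2)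
  have hcoupled := h.coupled_eq_zero hy hz hUΩ
  obtain ⟨hQ, e₁, e₂⟩ := hT.isGauge_polyQ hN hun (isConstants ρ)
    (fun w => directionalDerivation_comm _ _ w) (hm _) (fun k => (hT' k).1) (fun k => (hT' k).2)
    hcoupled.1 hcoupled.2 hP
  have hq' : Represents (qN N lam φ₁ φ₂ ρ q) (y - 2 * const U Complex.I * const U ρ *
      b.coeff (N - 1) + partialX U (b.coeff (N - 1))) := fun p => by
    simp only [qN, map_add, map_sub, map_mul, map_ofNat, evalAt_const, hy p, hb p, hb.dx p]
  have hr' : Represents (rN N lam φ₁ φ₂ ρ r) (z + 2 * const U Complex.I * const U ρ *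
      c.coeff (N - 1) + partialX U (c.coeff (N - 1))) := fun p => by
    simp only [rN, map_add, map_mul, map_ofNat, evalAt_const, hz p, hc p, hc.dx p]
  rw [← hU]
  exact ⟨isCoupledSolution_of_coupled_eq_zero hq' hr' e₁ e₂, _, _, _, _,
    hT.isDarbouxMatrix hlam h₁ h₂ hy hz hq' hr' hP hQ, fun x t hp =>
    ⟨(represents_toField _ ⟨(x, t), hp⟩).trans (hb ⟨(x, t), hp⟩).symm,
      (represents_toField _ ⟨(x, t), hp⟩).trans (hc ⟨(x, t), hp⟩).symm⟩⟩

end CoupledSystem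

/-! ### The nonlocal reduction -/

section Reflection

lemma dx_reflect (f : Field) : dx (reflect f) = fun x t => dx f (-x) (-t) := by
  ext x t
  change deriv (fun s => -f (-s) (-t)) x = deriv (fun s => f s (-t)) (-x)
  rw [deriv.fun_neg, deriv_comp_neg (fun s => f s (-t)), neg_neg]

lemma dt_reflect (f : Field) : dt (reflect f) = fun x t => dt f (-x) (-t) := by
  ext x t
  change deriv (fun s => -f (-x) (-s)) t = deriv (fun s => f (-x) s) (-t)
  rw [deriv.fun_neg, deriv_comp_neg (fun s => f (-x) s), neg_neg]

lemma dx_comp_neg (f : Field) : dx (fun x t => f (-x) (-t)) = reflect (dx f) := by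
  ext x t
  exact deriv_comp_neg (fun s => f s (-t)) x

variable {Ω : Set (ℝ × ℝ)} {f g : Field}

lemma dx_congr (hΩ : IsOpen Ω) (h : ∀ x t, (x, t) ∈ Ω → f x t = g x t) (x t : ℝ)
    (hp : (x, t) ∈ Ω) : dx f x t = dx g x t := by
  have hc : Continuous fun s : ℝ => (s, t) := by fun_prop
  exact Filter.EventuallyEq.deriv_eq
    (Filter.eventually_of_mem (hc.continuousAt.preimage_mem_nhds (hΩ.mem_nhds hp))
      fun s hs => h s t hs)

lemma dt_congr (hΩ : IsOpen Ω) (h : ∀ x t, (x, t) ∈ Ω → f x t = g x t) (x t : ℝ)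
    (hp : (x, t) ∈ Ω) : dt f x t = dt g x t := by
  have hc : Continuous fun s : ℝ => (x, s) := by fun_prop
  exact Filter.EventuallyEq.deriv_eq
    (Filter.eventually_of_mem (hc.continuousAt.preimage_mem_nhds (hΩ.mem_nhds hp))
      fun s hs => h x s hs)

lemma Smooth.reflect (h : Smooth Ω f) (hs : ∀ x t, (x, t) ∈ Ω → (-x, -t) ∈ Ω) :
    Smooth Ω (reflect f) :=
  ((ContDiffOn.comp h (contDiff_neg.contDiffOn (s := Ω)) fun _ hp => hs _ _ hp).neg :)

lemma Smooth.dx (h : Smooth Ω f) (hΩ : IsOpen Ω) : Smooth Ω (dx f) := by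
  obtain ⟨a, ha⟩ := exists_represents (U := ⟨Ω, hΩ⟩) h le_rfl
  exact ha.dx.smooth

lemma Smooth.hasDerivAt_dx (h : Smooth Ω f) (hΩ : IsOpen Ω) {x t : ℝ} (hp : (x, t) ∈ Ω) :
    HasDerivAt (fun s => f s t) (SelfSteepening.dx f x t) x := by
  have h1 : DifferentiableAt ℝ (fun p : ℝ × ℝ => f p.1 p.2) (x, t) :=
    (h.contDiffAt (hΩ.mem_nhds hp)).differentiableAt (by simp)
  have h2 : DifferentiableAt ℝ (fun s : ℝ => (s, t)) x := by fun_prop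
  exact (DifferentiableAt.comp (g := fun p : ℝ × ℝ => f p.1 p.2) x h1 h2).hasDerivAt

lemma IsCoupledSolution.congr {ρ : ℝ} {q r r' : Field} (hΩ : IsOpen Ω)
    (h : IsCoupledSolution ρ Ω q r) (hr : ∀ x t, (x, t) ∈ Ω → r x t = r' x t) :
    IsCoupledSolution ρ Ω q r' where
  smooth_q := h.smooth_q
  smooth_r := h.smooth_r.congr fun _ hp => (hr _ _ hp).symm
  eq_q x t hp := by
    rw [← hr x t hp, ← dx_congr hΩ hr x t hp]
    exact h.eq_q x t hp
  eq_r x t hp := by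
    have h1 := dx_congr hΩ hr
    have h2 := dx_congr hΩ h1
    rw [← hr x t hp, ← h1 x t hp, ← h2 x t hp, ← dx_congr hΩ h2 x t hp,
      ← dt_congr hΩ hr x t hp]
    exact h.eq_r x t hp

lemma IsDarbouxMatrix.congr {ρ : ℝ} {N : ℕ} {lam : Fin (2 * N) → ℂ}
    {φ₁ φ₂ : Fin (2 * N) → Field} {q r q' r' r'' : Field} {A₁ A₂ A₃ A₄ : ℕ → Field}
    (hΩ : IsOpen Ω) (h : IsDarbouxMatrix ρ Ω N lam φ₁ φ₂ q r q' r' A₁ A₂ A₃ A₄)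
    (hr : ∀ x t, (x, t) ∈ Ω → r' x t = r'' x t) :
    IsDarbouxMatrix ρ Ω N lam φ₁ φ₂ q r q' r'' A₁ A₂ A₃ A₄ where
  smooth := h.smooth
  kernel := h.kernel
  gauge_x l hl x t hp := by
    rw [h.gauge_x l hl x t hp, laxP, laxP, hr x t hp]
  gauge_t l hl x t hp := by
    have h1 := dx_congr hΩ hr
    rw [h.gauge_t l hl x t hp]
    simp only [laxQ, laxQ1, laxQ2, laxQ3, hr x t hp, h1 x t hp, dx_congr hΩ h1 x t hp]

/-- The total derivative in the nonlocal equation, expanded by the product rule. -/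
lemma dx_nonlocal_flux {q : Field} (hΩ : IsOpen Ω) (hs : ∀ x t, (x, t) ∈ Ω → (-x, -t) ∈ Ω)
    (hq : Smooth Ω q) {x t : ℝ} (hp : (x, t) ∈ Ω) :
    dx (fun y s => q y s * q (-y) (-s) * dx q y s
          + 1 / 2 * Complex.I * (q y s) ^ 3 * (q (-y) (-s)) ^ 2) x t
      = dx q x t * q (-x) (-t) * dx q x t - q x t * dx q (-x) (-t) * dx q x t
        + q x t * q (-x) (-t) * dx (dx q) x t
        + 3 / 2 * Complex.I * (q x t) ^ 2 * dx q x t * (q (-x) (-t)) ^ 2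
        - Complex.I * (q x t) ^ 3 * q (-x) (-t) * dx q (-x) (-t) := by
  have h0 := hq.hasDerivAt_dx hΩ hp
  have h1 : HasDerivAt (fun s => q (-s) (-t)) (-dx q (-x) (-t)) x := by
    simpa [dx_reflect, SelfSteepening.reflect] using ((hq.reflect hs).hasDerivAt_dx hΩ hp).fun_neg
  have h2 := (hq.dx hΩ).hasDerivAt_dx hΩ hp
  refine (((h0.fun_mul h1).fun_mul h2).fun_add
    (((h0.fun_pow 3).const_mul (1 / 2 * Complex.I)).fun_mul (h1.fun_pow 2))).deriv.trans ?_
  push_cast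
  ring

/-- The nonlocal equation is the coupled system under the reduction `r(x, t) = -q(-x, -t)`: the
second equation at a point is then the first one at the reflected point. -/
lemma isNonlocalSolution_iff {ρ : ℝ} {q : Field} (hΩ : IsOpen Ω)
    (hs : ∀ x t, (x, t) ∈ Ω → (-x, -t) ∈ Ω) :
    IsNonlocalSolution ρ Ω q ↔ IsCoupledSolution ρ Ω q (reflect q) := by
  refine ⟨fun h => ⟨h.smooth, h.smooth.reflect hs, fun x t hp => ?_, fun x t hp => ?_⟩,
    fun h => ⟨hs, h.smooth_q, fun x t hp => ?_⟩⟩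
  · have e := h.eq x t hp
    rw [dx_nonlocal_flux hΩ hs h.smooth hp] at e
    simp only [dx_reflect, reflect]
    linear_combination e
  · have e := h.eq (-x) (-t) (hs x t hp)
    rw [dx_nonlocal_flux hΩ hs h.smooth (hs x t hp)] at e
    simp only [neg_neg] at e
    simp only [dx_reflect, dt_reflect, dx_comp_neg, reflect]
    linear_combination e
  · have e := h.eq_q x t hp
    simp only [dx_reflect, reflect] at e
    rw [dx_nonlocal_flux hΩ hs h.smooth_q hp]
    linear_combination e

/-- The permutation that swaps the columns `2j` and `2j + 1` for every `j`. -/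
def swapPairs (N : ℕ) : Equiv.Perm (Fin (2 * N)) :=
  Function.Involutive.toPerm
    (fun c => ⟨if (c : ℕ) % 2 = 0 then c + 1 else c - 1, by have := c.2; split_ifs <;> omega⟩)
    fun c => Fin.ext (by dsimp only; split_ifs <;> omega)

lemma swapPairs_val {N : ℕ} (c : Fin (2 * N)) :
    (swapPairs N c : ℕ) = if (c : ℕ) % 2 = 0 then (c : ℕ) + 1 else c - 1 := rfl

variable {N : ℕ} (lam : Fin (2 * N) → ℂ) {φ₁ φ₂ : Fin (2 * N) → Field}

/-- Reflection turns `B12` into `B22` with the columns of each pair swapped; the same holds for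
`B11` and `B21`, so the sign of the permutation cancels in the quotients of determinants. -/
lemma B12_neg {x t : ℝ} (h₁ : ∀ k, φ₁ k (-x) (-t) = φ₂ k x t)
    (h₂ : ∀ k, φ₂ k (-x) (-t) = φ₁ k x t) :
    B12 N lam φ₁ φ₂ (-x) (-t) = (B22 N lam φ₁ φ₂ x t).submatrix id (swapPairs N) := by
  ext k c
  have hc := c.2
  have hv := swapPairs_val c
  simp only [B12, B22, Matrix.submatrix_apply, Matrix.of_apply, h₁, h₂, id]
  by_cases h : (c : ℕ) % 2 = 0
  · rw [if_pos h] at hv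
    rw [if_pos h, if_neg (by omega), hv, show 2 * N - 1 - (↑c + 1) = 2 * N - 2 - ↑c by omega]
  · rw [if_neg h] at hv
    rw [if_neg h, if_pos (by omega), hv, show 2 * N - 1 - (↑c - 1) = 2 * N - ↑c by omega]

lemma B11_neg {x t : ℝ} (h₁ : ∀ k, φ₁ k (-x) (-t) = φ₂ k x t)
    (h₂ : ∀ k, φ₂ k (-x) (-t) = φ₁ k x t) :
    B11 N lam φ₁ φ₂ (-x) (-t) = (B21 N lam φ₁ φ₂ x t).submatrix id (swapPairs N) := by
  ext k c
  simp only [B11, B21, Matrix.submatrix_apply, Matrix.of_apply, h₁, id, B12_neg lam h₁ h₂]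
  have hv := swapPairs_val c
  exact if_congr (by split_ifs at hv <;> omega) rfl rfl

lemma det_submatrix_swapPairs_eq_zero_iff (B : Matrix (Fin (2 * N)) (Fin (2 * N)) ℂ) :
    (B.submatrix id (swapPairs N)).det = 0 ↔ B.det = 0 := by
  rw [Matrix.det_permute', mul_eq_zero_iff_left (by simp)]

lemma A2top_neg {x t : ℝ} (h₁ : ∀ k, φ₁ k (-x) (-t) = φ₂ k x t)
    (h₂ : ∀ k, φ₂ k (-x) (-t) = φ₁ k x t) :
    A2top N lam φ₁ φ₂ (-x) (-t) = A3top N lam φ₁ φ₂ x t := by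
  rw [A2top, A3top, B12_neg lam h₁ h₂, B11_neg lam h₁ h₂, Matrix.det_permute',
    Matrix.det_permute', mul_div_mul_left _ _ (by simp)]

/-- The set of regular points is invariant under reflection. -/
lemma neg_mem_regularSet (hs : ∀ x t, (x, t) ∈ Ω → (-x, -t) ∈ Ω)
    (h : ∀ k x t, (x, t) ∈ Ω → φ₁ k x t = φ₂ k (-x) (-t)) (x t : ℝ)
    (hp : (x, t) ∈ regularSet N lam φ₁ φ₂ Ω) : (-x, -t) ∈ regularSet N lam φ₁ φ₂ Ω := by
  obtain ⟨hΩ, h12, h22⟩ := hp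
  have h₁ : ∀ k, φ₁ k (-x) (-t) = φ₂ k x t := fun k => by
    rw [h k _ _ (hs _ _ hΩ), neg_neg, neg_neg]
  have h₂ : ∀ k, φ₂ k (-x) (-t) = φ₁ k x t := fun k => (h k x t hΩ).symm
  refine ⟨hs x t hΩ, ?_, ?_⟩
  · rw [B12_neg lam h₁ h₂]
    exact (det_submatrix_swapPairs_eq_zero_iff _).not.mpr h22
  · have := B12_neg (x := -x) (t := -t) lam (φ₁ := φ₁) (φ₂ := φ₂)
      (by simpa only [neg_neg] using fun k => (h₂ k).symm)
      (by simpa only [neg_neg] using fun k => (h₁ k).symm)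
    rw [neg_neg, neg_neg] at this
    rw [ne_eq, ← det_submatrix_swapPairs_eq_zero_iff, ← this]
    exact h12

/-- The Darboux transformation respects the reduction `r(x, t) = -q(-x, -t)`. -/
lemma rN_reflect (hΩ : IsOpen Ω) (hs : ∀ x t, (x, t) ∈ Ω → (-x, -t) ∈ Ω)
    (h : ∀ k x t, (x, t) ∈ Ω → φ₁ k x t = φ₂ k (-x) (-t)) (ρ : ℝ) (q : Field) (x t : ℝ)
    (hp : (x, t) ∈ Ω) :
    rN N lam φ₁ φ₂ ρ (reflect q) x t = reflect (qN N lam φ₁ φ₂ ρ q) x t := by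
  have hA : ∀ x t, (x, t) ∈ Ω →
      A3top N lam φ₁ φ₂ x t = A2top N lam φ₁ φ₂ (-x) (-t) := fun x t hp =>
    (A2top_neg lam (fun k => by rw [h k _ _ (hs _ _ hp), neg_neg, neg_neg])
      fun k => (h k x t hp).symm).symm
  have hdA := dx_congr hΩ hA x t hp
  rw [dx_comp_neg] at hdA
  simp only [rN, qN, reflect, hA x t hp, hdA]
  ring

end Reflection

end SelfSteepening

theorem proposition1 (ρ : ℝ) (N : ℕ) (hN : 0 < N) (lam : Fin (2 * N) → ℂ)
    (hlam : ∀ k, lam k ≠ 0) (Ω : Set (ℝ × ℝ)) (hΩ : IsOpen Ω)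
    (q : SelfSteepening.Field) (φ₁ φ₂ : Fin (2 * N) → SelfSteepening.Field) :
    -- the N-fold Darboux transformation of the coupled system
    (∀ r : SelfSteepening.Field,
      SelfSteepening.IsCoupledSolution ρ Ω q r →
      (∀ k, SelfSteepening.IsEigenfunction ρ Ω q r (lam k) (φ₁ k) (φ₂ k)) →
      SelfSteepening.IsCoupledSolution ρ (SelfSteepening.regularSet N lam φ₁ φ₂ Ω)
          (SelfSteepening.qN N lam φ₁ φ₂ ρ q) (SelfSteepening.rN N lam φ₁ φ₂ ρ r) ∧
        ∃ A₁ A₂ A₃ A₄ : ℕ → SelfSteepening.Field,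
          SelfSteepening.IsDarbouxMatrix ρ (SelfSteepening.regularSet N lam φ₁ φ₂ Ω)
            N lam φ₁ φ₂ q r (SelfSteepening.qN N lam φ₁ φ₂ ρ q)
            (SelfSteepening.rN N lam φ₁ φ₂ ρ r) A₁ A₂ A₃ A₄ ∧
          ∀ x t, (x, t) ∈ SelfSteepening.regularSet N lam φ₁ φ₂ Ω →
            A₂ (N - 1) x t = SelfSteepening.A2top N lam φ₁ φ₂ x t ∧
            A₃ (N - 1) x t = SelfSteepening.A3top N lam φ₁ φ₂ x t) ∧
    -- its reduction to the reverse space-time nonlocal equation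
    (SelfSteepening.IsNonlocalSolution ρ Ω q →
      (∀ k, SelfSteepening.IsEigenfunction ρ Ω q (SelfSteepening.reflect q)
        (lam k) (φ₁ k) (φ₂ k)) →
      (∀ k x t, (x, t) ∈ Ω → φ₁ k x t = φ₂ k (-x) (-t)) →
      SelfSteepening.IsNonlocalSolution ρ (SelfSteepening.regularSet N lam φ₁ φ₂ Ω)
          (SelfSteepening.qN N lam φ₁ φ₂ ρ q) ∧
        (∀ x t, (x, t) ∈ SelfSteepening.regularSet N lam φ₁ φ₂ Ω →
          SelfSteepening.rN N lam φ₁ φ₂ ρ (SelfSteepening.reflect q) x t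
            = SelfSteepening.reflect (SelfSteepening.qN N lam φ₁ φ₂ ρ q) x t) ∧
        ∃ A₁ A₂ A₃ A₄ : ℕ → SelfSteepening.Field,
          SelfSteepening.IsDarbouxMatrix ρ (SelfSteepening.regularSet N lam φ₁ φ₂ Ω)
            N lam φ₁ φ₂ q (SelfSteepening.reflect q) (SelfSteepening.qN N lam φ₁ φ₂ ρ q)
            (SelfSteepening.reflect (SelfSteepening.qN N lam φ₁ φ₂ ρ q)) A₁ A₂ A₃ A₄ ∧
          ∀ x t, (x, t) ∈ SelfSteepening.regularSet N lam φ₁ φ₂ Ω →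
            A₂ (N - 1) x t = SelfSteepening.A2top N lam φ₁ φ₂ x t ∧
            A₃ (N - 1) x t = SelfSteepening.A3top N lam φ₁ φ₂ x t) := by
  refine ⟨fun r h hφ => h.darboux hN hlam hΩ hφ, fun h hφ hsymm => ?_⟩
  obtain ⟨hsol, A₁, A₂, A₃, A₄, hA, htop⟩ :=
    ((SelfSteepening.isNonlocalSolution_iff hΩ h.symm).mp h).darboux hN hlam hΩ hφ
  have hU := SelfSteepening.isOpen_regularSet lam hΩ (fun k => (hφ k).smooth₁)
    fun k => (hφ k).smooth₂
  have hr : ∀ x t, (x, t) ∈ SelfSteepening.regularSet N lam φ₁ φ₂ Ω →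
      SelfSteepening.rN N lam φ₁ φ₂ ρ (SelfSteepening.reflect q) x t
        = SelfSteepening.reflect (SelfSteepening.qN N lam φ₁ φ₂ ρ q) x t := fun x t hp =>
    SelfSteepening.rN_reflect lam hΩ h.symm hsymm ρ q x t hp.1
  exact ⟨(SelfSteepening.isNonlocalSolution_iff hU
    (SelfSteepening.neg_mem_regularSet lam h.symm hsymm)).mpr (hsol.congr hU hr), hr,
    A₁, A₂, A₃, A₄, hA.congr hU hr, htop⟩
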